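/- Let $(X_i,Y_i)$, $i\ge 1$, be independent copies of a random pair $(X,Y)\in\mathbb R^p\times\mathbb R$, where $X$ has a probability density $g$ on $\mathbb R^p$ which is Lipschitz ($|g(u)-g(v)|\le c_g\|u-v\|$ for all $u,v$, for the Euclidean norm), and fix a regular version of the conditional law of $Y$ given $X$, with conditional survival function $\bar F(y|x)=\mathbb P(Y>y\mid X=x)$. Put $q(\alpha|x)=\inf\{t:\bar F(t|x)\le\alpha\}$ and let $y_F(x)=q(0|x)\in(-\infty,\infty]$ be the right endpoint. Let $K$ be a bounded probability density on $\mathbb R^p$ vanishing outside the unit ball, $K_h(t)=K(t/h)/h^p$, let $h=h_n>0$ be a nonrandom sequence with $h_n\to0$, and let $$\hat{\bar F}_n(y|x)=\frac{\sum_{i=1}^nK_h(x-X_i)\mathbf 1\{Y_i>y\}}{\sum_{i=1}^nK_h(x-X_i)},\qquad \hat q_n(\alpha|x)=\inf\{t:\hat{\bar F}_n(t|x)\le\alpha\}.$$ Fix $x\in\mathbb R^p$ with $g(x)>0$. Assume the von Mises condition at $x$ with index $\gamma(x)\in\mathbb R$: $\bar F(\cdot|x)$ is continuous on $\mathbb R$,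 is twice differentiable with nonzero first derivative in a left neighbourhood of $y_F(x)$, and $$\lim_{y\uparrow y_F(x)}\frac{\bar F(y|x)\,\bar F''(y|x)}{(\bar F'(y|x))^2}=\gamma(x)+1 .$$ If $\gamma(x)<0$, assume also $y_F(x)\neq0$. Let $a(\cdot|x)$ be any auxiliary function, that is, a function, positive in a left neighbourhood of $y_F(x)$, such that $$\lim_{y\uparrow y_F(x)}\frac{\bar F(y+t\,a(y|x)\,|\,x)}{\bar F(y|x)}=\frac1{K_{\gamma(x)}^{-1}(t)}\quad\text{for all } t \text{ with } 1+t\gamma(x)>0,$$ where $K_z^{-1}$ is the inverse of $K_z(u)=\int_1^uv^{z-1}\,dv$, $u>0$. For $0<\kappa<r$ and $\alpha>0$ let $$\Delta_{\kappa,r}(x,\alpha)=\sup\Bigl\{\Bigl|\frac{\bar F(q(\beta|x)|x')}{\beta}-1\Bigr| : \|x'-x\|<h_n,\ \kappa\alpha\le\beta\le r\alpha\Bigr\}.$$ Let $J\ge1$ and $0<\tau_J<\dots<\tau_2<\tau_1\le1$. Suppose that $\alpha_n\to0$, that $nh_n^p\alpha_n\to\infty$, and that there are $\kappa\in(0,\tau_J)$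 and $r>\tau_1$ (if $\tau_1<1$ one may take $r=1$) with $$nh_n^p\alpha_n\bigl(h_n\vee\Delta_{\kappa,r}(x,\alpha_n)\bigr)^2\to0 .$$ Then the matrix $\tilde\Sigma(x)$ with entries $\tilde\Sigma_{j,j'}(x)=(\tau_j\tau_{j'})^{-(\gamma(x)\wedge0)}\,\tau_{j\wedge j'}^{-1}$, $1\le j,j'\le J$, is such that $\frac{\|K\|_2^2}{g(x)}\tilde\Sigma(x)$ is positive semidefinite, and the random vector $$\Bigl\{\sqrt{nh_n^p\alpha_n}\;\frac{q(\alpha_n|x)}{a(q(\alpha_n|x)|x)}\Bigl(\frac{\hat q_n(\tau_j\alpha_n|x)}{q(\tau_j\alpha_n|x)}-1\Bigr)\Bigr\}_{j=1,\dots,J}$$ converges in distribution to the centered Gaussian law on $\mathbb R^J$ with covariance matrix $\frac{\|K\|_2^2}{g(x)}\tilde\Sigma(x)$, where $\|K\|_2^2=\int K^2$. -/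

import Mathlib

open MeasureTheory ProbabilityTheory Filter Topology Set

noncomputable section

namespace ExtremeQuantile

/-- The space `ℝ^p` with its Euclidean norm. -/
abbrev Cov (p : ℕ) : Type := EuclideanSpace ℝ (Fin p)

/-- The generalized inverse `G^←(α) = inf {t, G(t) ≤ α}` of a nonincreasing function `G`. -/
def genInv (G : ℝ → ℝ) (α : ℝ) : ℝ := sInf {t : ℝ | G t ≤ α}

/-- The right endpoint `inf {t, G(t) ≤ 0}` of a survival function `G`, an extended real number
(it is `⊤` if `G` never vanishes). -/
def endpoint (G : ℝ → ℝ) : EReal := sInf (Real.toEReal '' {t : ℝ | G t ≤ 0})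

/-- The filter of the real numbers `y ↑ e`: left neighbourhoods of `e` if `e` is real,
neighbourhoods of `+∞` if `e = ⊤`. -/
def upTo (e : EReal) : Filter ℝ := comap Real.toEReal (𝓝[<] e)

/-- `K_z(u) = ∫_1^u v^(z-1) dv`. -/
def primK (z u : ℝ) : ℝ := ∫ v in (1 : ℝ)..u, v ^ (z - 1)

/-- The von Mises condition with extreme-value index `γ` for a survival function `G`: `G` is
continuous, twice differentiable with non-zero first derivative in a left neighbourhood of its
endpoint, and `G G'' / (G')² → γ + 1` at the endpoint. -/
structure VonMises (G : ℝ → ℝ) (γ : ℝ) : Prop where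
  continuous : Continuous G
  differentiable : ∀ᶠ y in upTo (endpoint G), DifferentiableAt ℝ G y
  twice_differentiable : ∀ᶠ y in upTo (endpoint G), DifferentiableAt ℝ (deriv G) y
  deriv_ne_zero : ∀ᶠ y in upTo (endpoint G), deriv G y ≠ 0
  tendsto : Tendsto (fun y => G y * deriv (deriv G) y / (deriv G y) ^ 2)
    (upTo (endpoint G)) (𝓝 (γ + 1))

/-- `a` is an auxiliary function of the survival function `G` with index `γ`: it is positive near
the endpoint, and `G(y + t a(y)) / G(y) → 1 / K_γ⁻¹(t)` as `y` increases to the endpoint, for all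
`t` with `1 + t γ > 0`. Such `t` are the values `t = K_γ(u)`, `u > 0`. -/
structure IsAuxiliary (G : ℝ → ℝ) (γ : ℝ) (a : ℝ → ℝ) : Prop where
  pos : ∀ᶠ y in upTo (endpoint G), 0 < a y
  tendsto : ∀ u : ℝ, 0 < u → Tendsto (fun y => G (y + primK γ u * a y) / G y)
    (upTo (endpoint G)) (𝓝 (1 / u))

/-- `K` is a bounded probability density function on `ℝ^p` supported in the unit ball. -/
structure IsBoundedDensity {p : ℕ} (K : Cov p → ℝ) : Prop where
  measurable : Measurable K
  nonneg : ∀ u, 0 ≤ K u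
  integral_eq_one : ∫ u, K u = 1
  bounded : ∃ M : ℝ, ∀ u, K u ≤ M
  support_subset : Function.support K ⊆ Metric.closedBall 0 1

/-- The rescaled kernel `K_h(t) = K(t/h) / h^p`. -/
def rescaled {p : ℕ} (K : Cov p → ℝ) (h : ℝ) (t : Cov p) : ℝ := K (h⁻¹ • t) / h ^ p

/-- The conditional survival function `y ↦ P(Y > y | X = x)`, where `Q` is the conditional law
of `Y` given `X`. -/
def csf {p : ℕ} (Q : Kernel (Cov p) ℝ) (x : Cov p) (y : ℝ) : ℝ := (Q x).real (Ioi y)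

/-- The conditional quantile `q(α|x)`. -/
def quantile {p : ℕ} (Q : Kernel (Cov p) ℝ) (x : Cov p) (α : ℝ) : ℝ := genInv (csf Q x) α

/-- The oscillation of the conditional survival function: the supremum of
`|P(Y > q(β|x) | X = x') / β - 1|` over `x'` in the ball `B(x,h)` and `β ∈ [κ α, r α]`. -/
def oscillation {p : ℕ} (Q : Kernel (Cov p) ℝ) (x : Cov p) (h κ r α : ℝ) : ℝ :=
  sSup ((fun z : Cov p × ℝ => |csf Q z.1 (quantile Q x z.2) / z.2 - 1|) ''
    (Metric.ball x h ×ˢ Icc (κ * α) (r * α)))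

/-- The kernel estimator of the conditional survival function at `(x, y)`, computed from the
`n` observations `(X i, Y i)`, `i < n`. -/
def csfEst {p : ℕ} (K : Cov p → ℝ) (h : ℝ) (n : ℕ) (X : ℕ → Cov p) (Y : ℕ → ℝ)
    (x : Cov p) (y : ℝ) : ℝ :=
  (∑ i ∈ Finset.range n, rescaled K h (x - X i) * (Ioi y).indicator 1 (Y i)) /
    ∑ i ∈ Finset.range n, rescaled K h (x - X i)

/-- The kernel estimator of the conditional quantile `q(α|x)`. -/
def quantileEst {p : ℕ} (K : Cov p → ℝ) (h : ℝ) (n : ℕ) (X : ℕ → Cov p) (Y : ℕ → ℝ)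
    (x : Cov p) (α : ℝ) : ℝ :=
  genInv (csfEst K h n X Y x) α

/-- `(X i, Y i)`, `i = 0, 1, …`, are independent copies of a random pair with values in
`ℝ^p × ℝ` such that the first component has density `g` and `Q` is the conditional law of the
second component given the first one. -/
structure IsSample {p : ℕ} {Ω : Type*} [MeasurableSpace Ω] (P : Measure Ω)
    (g : Cov p → ℝ) (Q : Kernel (Cov p) ℝ) (X : ℕ → Ω → Cov p) (Y : ℕ → Ω → ℝ) : Prop where
  measurable_fst : ∀ i, Measurable (X i)
  measurable_snd : ∀ i, Measurable (Y i)
  indep : iIndepFun (fun i ω => (X i ω, Y i ω)) P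
  density_measurable : Measurable g
  density_nonneg : ∀ x, 0 ≤ g x
  law_fst : ∀ i, P.map (X i) = volume.withDensity (fun x => ENNReal.ofReal (g x))
  law_pair : ∀ i, P.map (fun ω => (X i ω, Y i ω)) =
    (volume.withDensity (fun x => ENNReal.ofReal (g x))) ⊗ₘ Q

/-- The matrix with entries `c (τ_j τ_j')^(-(γ ∧ 0)) / τ_{j ∧ j'}`. -/
def limitCov {J : ℕ} (c γ : ℝ) (τ : Fin J → ℝ) : Matrix (Fin J) (Fin J) ℝ :=
  Matrix.of fun j j' => c * ((τ j * τ j') ^ (-(min γ 0)) * (τ (min j j'))⁻¹)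

end ExtremeQuantile

end

namespace ExtremeQuantile

/-! ### Generalized inverses and endpoints -/

/-! Put σ = √(n h^p α). The estimator is not linear in the data, but its distribution events are: as
long as the smoothing weights do not all vanish, the estimated quantile of level c is at most t
exactly when the row sum of K((x - X_i)/h) (1{Y_i > t} - c) is nonpositive (`quantileEst_le_iff`).
Taking for t the true quantile of level τ α exp(-v/σ) turns the event "normalized error ≤ z_n(v)"
into "W_n ≤ D_n(v)". Here W_n is a multiple of the row sum at v = 0, and D_n(v) is the same multiple
of the difference of the row sums at 0 and at v.

Two limits identify both sides. Analytically, z_n(v) tends to a multiple of v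
(`tendsto_quantile_increment`). Indeed U(s) = q(e^{-s}) has derivative V = -G/G' evaluated at U(s),
and the von Mises condition says exactly that V'/V tends to γ (`hasTailIndex`). Hence V(s+w)/V(s) →
e^{γw}, every auxiliary function is equivalent to V, and V/U → γ ∨ 0. The factor τ^{-(γ∧0)} comes
from γ - γ ∨ 0 = γ ∧ 0. Probabilistically, D_n(v) has a convergent mean and a vanishing variance,
because the exceedances of two neighbouring quantiles differ on a set of conditional mass o(α). The
oscillation condition makes the bias negligible at scale σ.

A comparison argument on a finite grid (`tendstoInMeasure_sub_of_comparison`) then shows that the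
normalized error minus W_n tends to 0 in probability. The vector of the W_n is a row sum of
independent, uniformly small terms. Its characteristic function converges
(`tendsto_integral_exp_sum`), with a variance given by the product moments of nested exceedances
(`tendsto_integral_score_mul`), and Slutsky's lemma concludes. -/

lemma genInv_le_iff {G : ℝ → ℝ} (hG : Antitone G)
    (hrc : ∀ t, ContinuousWithinAt G (Ici t) t) {c : ℝ} (hne : ∃ t, G t ≤ c)
    (hbd : ∃ t, c < G t) {t : ℝ} : genInv G c ≤ t ↔ G t ≤ c := by
  have hlow : ∀ t', c < G t' → ∀ u ∈ {t : ℝ | G t ≤ c}, t' ≤ u := by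
    intro t' ht' u hu
    by_contra! hlt
    exact absurd (hG hlt.le) (not_le.2 (lt_of_le_of_lt hu ht'))
  constructor
  · intro hle
    by_contra! hlt
    have hev : ∀ᶠ u in 𝓝[>] t, c < G u :=
      ((hrc t).eventually_const_lt hlt).filter_mono (nhdsWithin_mono _ Ioi_subset_Ici_self)
    obtain ⟨u, hu, htu⟩ := (hev.and self_mem_nhdsWithin).exists
    exact absurd (le_csInf hne (hlow u hu)) (not_le.2 (lt_of_le_of_lt hle htu))
  · intro hle
    obtain ⟨t', ht'⟩ := hbd
    exact csInf_le ⟨t', fun u hu => hlow t' ht' u hu⟩ hle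

/-- A real threshold below the endpoint serves finite and infinite endpoints alike. -/
lemma eventually_upTo {e : EReal} (he : e ≠ ⊥) {p : ℝ → Prop} :
    (∀ᶠ y in upTo e, p y) ↔
      ∃ y₀ : ℝ, (y₀ : EReal) < e ∧ ∀ y : ℝ, y₀ < y → (y : EReal) < e → p y := by
  have hb := (nhdsLT_basis_of_exists_lt ⟨⊥, bot_lt_iff_ne_bot.2 he⟩).comap Real.toEReal
  rw [upTo, hb.eventually_iff]
  constructor
  · rintro ⟨u, hu, H⟩
    obtain ⟨y₀, h1, h2⟩ := EReal.lt_iff_exists_real_btwn.1 hu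
    exact ⟨y₀, h2, fun y hy hye => H ⟨h1.trans (EReal.coe_lt_coe_iff.2 hy), hye⟩⟩
  · rintro ⟨y₀, h1, H⟩
    exact ⟨y₀, h1, fun y hy => H y (EReal.coe_lt_coe_iff.1 hy.1) hy.2⟩

/-- By continuity positivity persists slightly to the right of `t`, so the endpoint is strictly
larger and is not itself a point of positivity. -/
lemma pos_iff_lt_endpoint {G : ℝ → ℝ} (hG : Antitone G) (hc : Continuous G) {t : ℝ} :
    0 < G t ↔ (t : EReal) < endpoint G := by
  constructor
  · intro h
    by_contra! hle
    have hev : ∀ᶠ u in 𝓝[>] t, 0 < G u :=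
      (hc.continuousAt.eventually_const_lt h).filter_mono nhdsWithin_le_nhds
    obtain ⟨u, hu, htu⟩ := (hev.and self_mem_nhdsWithin).exists
    obtain ⟨_, ⟨w, hw, rfl⟩, hwu⟩ :=
      sInf_lt_iff.1 (lt_of_le_of_lt hle (EReal.coe_lt_coe_iff.2 (mem_Ioi.1 htu)))
    have : G u ≤ G w := hG (EReal.coe_lt_coe_iff.1 hwu).le
    exact absurd hu (not_lt.2 (this.trans hw))
  · intro h
    by_contra! hle
    exact absurd h (not_lt.2 (sInf_le ⟨t, hle, rfl⟩))

lemma endpoint_ne_bot {G : ℝ → ℝ} (hG : Antitone G) (hc : Continuous G)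
    (h1 : Tendsto G atBot (𝓝 1)) : endpoint G ≠ ⊥ := by
  obtain ⟨t, ht⟩ := (h1.eventually_const_lt zero_lt_one).exists
  exact ne_bot_of_gt ((pos_iff_lt_endpoint hG hc).1 ht)

/-! ### Functions with a convergent logarithmic derivative -/

/-- The function log f(u) - m u has derivative c(u) - m, which tends to 0, so its increments over
bounded steps vanish. The steps need only be bounded, not convergent: intermediate points from mean
value theorems will be inserted. -/
lemma tendsto_ratio_mul_exp_neg {f c : ℝ → ℝ} {m : ℝ} (hpos : ∀ᶠ s in atTop, 0 < f s)
    (hder : ∀ᶠ s in atTop, HasDerivAt f (c s * f s) s) (hc : Tendsto c atTop (𝓝 m))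
    {ι : Type*} {l : Filter ι} {s v : ι → ℝ} {M : ℝ} (hs : Tendsto s l atTop)
    (hv : ∀ᶠ i in l, |v i| ≤ M) :
    Tendsto (fun i => f (s i + v i) / f (s i) * Real.exp (-(m * v i))) l (𝓝 1) := by
  have hφ : Tendsto (fun i => (Real.log (f (s i + v i)) - m * (s i + v i)) -
      (Real.log (f (s i)) - m * s i)) l (𝓝 0) := by
    rw [Metric.tendsto_nhds]
    intro ε hε
    -- `M` may be of any sign; the added 1 keeps the denominator positive and η |M| strictly below
    -- ε.
    set η := ε / (|M| + 1) with hη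
    have hη0 : 0 < η := by positivity
    obtain ⟨S, hS⟩ := eventually_atTop.1
      (hpos.and (hder.and (hc.eventually (Metric.closedBall_mem_nhds m hη0))))
    filter_upwards [hs.eventually_ge_atTop (S + |M|), hv] with i hsi hvi
    have hvM : |v i| ≤ |M| := hvi.trans (le_abs_self M)
    have h1 : S ≤ s i := by linarith [abs_nonneg M]
    have h2 : S ≤ s i + v i := by linarith [neg_abs_le (v i)]
    have := Convex.norm_image_sub_le_of_norm_hasDerivWithin_le (𝕜 := ℝ) (C := η) (s := Ici S)
      (f := fun u => Real.log (f u) - m * u) (f' := fun u => c u - m) (x := s i) (y := s i + v i)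
      (fun u hu => by
        obtain ⟨hp, hd, -⟩ := hS u hu
        have := ((hd.log hp.ne').sub ((hasDerivAt_id u).const_mul m)).hasDerivWithinAt (s := Ici S)
        convert! this using 1
        field_simp)
      (fun u hu => by simpa [Real.dist_eq] using (hS u hu).2.2) (convex_Ici S) h1 h2
    rw [Real.dist_eq, sub_zero]
    calc _ ≤ η * |v i| := by simpa using this
      _ ≤ η * |M| := by gcongr
      _ < ε := by rw [hη, div_mul_eq_mul_div, div_lt_iff₀ (by positivity)]; nlinarith [abs_nonneg M]
  have hexp := (Real.continuous_exp.tendsto 0).comp hφ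
  rw [Real.exp_zero] at hexp
  obtain ⟨S, hS⟩ := eventually_atTop.1 hpos
  refine hexp.congr' ?_
  filter_upwards [hs.eventually_ge_atTop (S + |M|), hv] with i hsi hvi
  have hvM : |v i| ≤ |M| := hvi.trans (le_abs_self M)
  have p1 := hS (s i) (by linarith [abs_nonneg M])
  have p2 := hS (s i + v i) (by linarith [neg_abs_le (v i)])
  simp only [Function.comp]
  rw [show (Real.log (f (s i + v i)) - m * (s i + v i)) - (Real.log (f (s i)) - m * s i) =
    Real.log (f (s i + v i)) - Real.log (f (s i)) + -(m * v i) by ring, Real.exp_add,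
    Real.exp_sub, Real.exp_log p1, Real.exp_log p2]

lemma tendsto_ratio {f c : ℝ → ℝ} {m : ℝ} (hpos : ∀ᶠ s in atTop, 0 < f s)
    (hder : ∀ᶠ s in atTop, HasDerivAt f (c s * f s) s) (hc : Tendsto c atTop (𝓝 m))
    {ι : Type*} {l : Filter ι} {s v : ι → ℝ} {w : ℝ} (hs : Tendsto s l atTop)
    (hv : Tendsto v l (𝓝 w)) :
    Tendsto (fun i => f (s i + v i) / f (s i)) l (𝓝 (Real.exp (m * w))) := by
  have hb : ∀ᶠ i in l, |v i| ≤ |w| + 1 :=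
    (hv.abs.eventually_lt_const (lt_add_one |w|)).mono fun i hi => hi.le
  have h := (tendsto_ratio_mul_exp_neg hpos hder hc hs hb).mul
    ((Real.continuous_exp.tendsto _).comp (hv.const_mul m))
  rw [one_mul] at h
  refine h.congr fun i => ?_
  simp only [Function.comp]
  rw [mul_assoc, ← Real.exp_add, neg_add_cancel, Real.exp_zero, mul_one]

/-! ### The primitive of a power function -/

/-- In the variable w = log u the model function has logarithmic second derivative exactly γ, with
no separate case γ = 0. -/
lemma hasDerivAt_primK_exp (γ w : ℝ) :
    HasDerivAt (fun w => primK γ (Real.exp w)) (Real.exp (γ * w)) w := by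
  have hcont : ContinuousOn (fun v : ℝ => v ^ (γ - 1)) (Ioi 0) := fun v hv =>
    (Real.continuousAt_rpow_const v _ (Or.inl (ne_of_gt hv))).continuousWithinAt
  have hexp := Real.exp_pos w
  have h1 : HasDerivAt (primK γ) (Real.exp w ^ (γ - 1)) (Real.exp w) := by
    refine intervalIntegral.integral_hasDerivAt_right ?_ ?_ ?_
    · refine (hcont.mono ?_).intervalIntegrable
      intro v hv
      exact lt_of_lt_of_le (lt_min one_pos hexp) hv.1
    · exact hcont.stronglyMeasurableAtFilter isOpen_Ioi _ hexp
    · exact hcont.continuousAt (Ioi_mem_nhds hexp)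
  have := h1.comp w (Real.hasDerivAt_exp w)
  convert! this using 1
  rw [← Real.exp_mul, ← Real.exp_add]
  ring_nf

lemma primK_one (γ : ℝ) : primK γ 1 = 0 := by simp [primK]

lemma strictMono_primK_exp (γ : ℝ) : StrictMono fun w => primK γ (Real.exp w) :=
  strictMono_of_deriv_pos fun w => by
    rw [(hasDerivAt_primK_exp γ w).deriv]; exact Real.exp_pos _

/-! ### Increments of a function whose derivative has a convergent logarithmic derivative -/

/-- `V` is eventually the derivative of `U`, is eventually positive, and has logarithmic
derivative `c`, which converges to `γ`. -/
structure HasTailIndex (U V c : ℝ → ℝ) (γ : ℝ) : Prop where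
  deriv_fst : ∀ᶠ s in atTop, HasDerivAt U (V s) s
  pos : ∀ᶠ s in atTop, 0 < V s
  deriv_snd : ∀ᶠ s in atTop, HasDerivAt V (c s * V s) s
  tendsto : Tendsto c atTop (𝓝 γ)

namespace HasTailIndex

variable {U V c : ℝ → ℝ} {γ : ℝ}

/-- By the mean value theorem the increment is V(s+θ) v with |θ| ≤ |v| → 0, and V(s+θ)/V(s) → 1. -/
lemma tendsto_mul_increment (H : HasTailIndex U V c γ) {ι : Type*} {l : Filter ι}
    {s v σ : ι → ℝ} {w : ℝ} (hs : Tendsto s l atTop) (hv : Tendsto v l (𝓝 0))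
    (hσ : Tendsto (fun i => σ i * v i) l (𝓝 w)) :
    Tendsto (fun i => σ i * (U (s i + v i) - U (s i)) / V (s i)) l (𝓝 w) := by
  obtain ⟨S, hS⟩ := eventually_atTop.1 H.deriv_fst
  -- The bound on θ is unconditional and the identity conditional, so that `choose` yields a θ for
  -- every index; outside the good range θ = 0.
  have hmvt : ∀ i, ∃ θ : ℝ, |θ| ≤ |v i| ∧ (S ≤ s i → S ≤ s i + v i →
      U (s i + v i) - U (s i) = V (s i + θ) * v i) := by
    intro i
    rcases lt_trichotomy (v i) 0 with hneg | hz | hpos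
    · by_cases h2 : S ≤ s i + v i
      · obtain ⟨ξ, hξ, he⟩ := exists_hasDerivAt_eq_slope U V (a := s i + v i) (b := s i)
          (by linarith)
          (fun u hu => (hS u (h2.trans hu.1)).continuousAt.continuousWithinAt)
          (fun u hu => hS u (h2.trans hu.1.le))
        refine ⟨ξ - s i, ?_, fun _ _ => ?_⟩
        · rw [abs_of_neg hneg, abs_of_neg (by linarith [hξ.2])]; linarith [hξ.1]
        · rw [add_sub_cancel, he]
          have : s i - (s i + v i) ≠ 0 := by intro h; linarith
          field_simp
          ring
      · exact ⟨0, by simp, fun _ h => absurd h h2⟩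
    · exact ⟨0, by simp, fun _ _ => by simp [hz]⟩
    · by_cases h1 : S ≤ s i
      · obtain ⟨ξ, hξ, he⟩ := exists_hasDerivAt_eq_slope U V (a := s i) (b := s i + v i)
          (by linarith)
          (fun u hu => (hS u (h1.trans hu.1)).continuousAt.continuousWithinAt)
          (fun u hu => hS u (h1.trans hu.1.le))
        refine ⟨ξ - s i, ?_, fun _ _ => ?_⟩
        · rw [abs_of_pos hpos, abs_of_pos (by linarith [hξ.1])]; linarith [hξ.2]
        · rw [add_sub_cancel, he]
          have : s i + v i - s i ≠ 0 := by intro h; linarith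
          field_simp
          ring
      · exact ⟨0, by simp, fun h => absurd h h1⟩
  choose θ hθ hUθ using hmvt
  have hθ0 : Tendsto θ l (𝓝 0) := by
    have := hv.abs
    rw [abs_zero] at this
    exact squeeze_zero_norm hθ this
  have hr := tendsto_ratio H.pos H.deriv_snd H.tendsto hs hθ0
  have := hσ.mul hr
  rw [mul_zero, Real.exp_zero, mul_one] at this
  refine this.congr' ?_
  filter_upwards [hs.eventually_ge_atTop (S + 1), hv.eventually (Metric.ball_mem_nhds 0 one_pos)]
    with i h1 h2
  rw [Real.dist_eq, sub_zero] at h2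
  rw [hUθ i (by linarith) (by linarith [(abs_lt.1 h2).1])]
  ring

/-- Cauchy's mean value theorem against the model u ↦ K_γ(e^{u-s}) gives the ratio of increments as
V(s+θ) e^{-γθ} for some θ in (0, w). This θ need not converge, whence the uniform form of the ratio
limit. -/
lemma tendsto_increment (H : HasTailIndex U V c γ) {w : ℝ} (hw : 0 < w) :
    Tendsto (fun s => (U (s + w) - U s) / V s) atTop (𝓝 (primK γ (Real.exp w))) := by
  obtain ⟨S, hS⟩ := eventually_atTop.1 H.deriv_fst
  have hmvt : ∀ s, ∃ θ : ℝ, |θ| ≤ w ∧ (S ≤ s →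
      U (s + w) - U s = primK γ (Real.exp w) * (V (s + θ) * Real.exp (-(γ * θ)))) := by
    intro s
    by_cases h1 : S ≤ s
    · have hE : ∀ u, HasDerivAt (fun u => primK γ (Real.exp (u - s)))
          (Real.exp (γ * (u - s))) u := fun u => by
        simpa using (hasDerivAt_primK_exp γ (u - s)).comp_sub_const u s
      obtain ⟨ξ, hξ, he⟩ := exists_ratio_hasDerivAt_eq_ratio_slope U V (a := s) (b := s + w)
        (by linarith)
        (fun u hu => (hS u (h1.trans hu.1)).continuousAt.continuousWithinAt)
        (fun u hu => hS u (h1.trans hu.1.le)) (fun u => primK γ (Real.exp (u - s)))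
        (fun u => Real.exp (γ * (u - s)))
        (fun u hu => (hE u).continuousAt.continuousWithinAt) (fun u hu => hE u)
      refine ⟨ξ - s, ?_, fun _ => ?_⟩
      · rw [abs_of_pos (by linarith [hξ.1])]; linarith [hξ.2]
      · simp only [add_sub_cancel_left, sub_self, Real.exp_zero, primK_one, sub_zero] at he
        rw [add_sub_cancel, ← mul_assoc, he, mul_assoc, ← Real.exp_add, add_neg_cancel,
          Real.exp_zero, mul_one]
    · exact ⟨0, by simpa using hw.le, fun h => absurd h h1⟩
  choose θ hθ hUθ using hmvt
  have hr := (tendsto_ratio_mul_exp_neg H.pos H.deriv_snd H.tendsto tendsto_id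
    (Eventually.of_forall hθ)).const_mul (primK γ (Real.exp w))
  rw [mul_one] at hr
  refine hr.congr' ?_
  filter_upwards [eventually_ge_atTop S] with s hs
  rw [hUθ s hs]
  simp only [id]
  ring

/-- The derivative of V - γU is (c - γ)V, eventually dominated by εV = (εU)'. Hence εU ± (V - γU)
are both nondecreasing. -/
lemma abs_sub_le (H : HasTailIndex U V c γ) {ε : ℝ} (hε : 0 < ε) : ∀ᶠ S in atTop, ∀ s ≥ S,
    |(V s - γ * U s) - (V S - γ * U S)| ≤ ε * (U s - U S) := by
  obtain ⟨S₀, hS₀⟩ := eventually_atTop.1 (H.deriv_fst.and (H.pos.and (H.deriv_snd.and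
    (H.tendsto.eventually (Metric.closedBall_mem_nhds γ hε)))))
  filter_upwards [eventually_ge_atTop S₀] with S hSS s hs
  have key : ∀ δ : ℝ, |δ| ≤ 1 →
      MonotoneOn (fun s => ε * U s + δ * (V s - γ * U s)) (Ici S) := by
    intro δ hδ
    have hd : ∀ u ∈ Ici S, HasDerivAt (fun s => ε * U s + δ * (V s - γ * U s))
        (ε * V u + δ * (c u * V u - γ * V u)) u := fun u hu => by
      obtain ⟨h1, -, h3, -⟩ := hS₀ u (hSS.trans hu)
      exact (h1.const_mul ε).add ((h3.sub (h1.const_mul γ)).const_mul δ)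
    refine monotoneOn_of_hasDerivWithinAt_nonneg (convex_Ici S)
      (fun u hu => (hd u hu).continuousAt.continuousWithinAt)
      (fun u hu => (hd u (interior_subset hu)).hasDerivWithinAt) fun u hu => ?_
    obtain ⟨-, h2, -, h4⟩ := hS₀ u (hSS.trans (interior_subset hu))
    have h4' : |c u - γ| ≤ ε := by simpa [Real.dist_eq] using h4
    have : |δ * (c u - γ)| ≤ ε := by
      rw [abs_mul]; nlinarith [abs_nonneg δ, abs_nonneg (c u - γ)]
    have := (abs_le.1 this).1
    nlinarith
  have k1 := key 1 (by simp) self_mem_Ici hs hs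
  have k2 := key (-1) (by simp) self_mem_Ici hs hs
  simp only at k1 k2
  rw [abs_le]
  constructor <;> linarith

lemma tendsto_div_of_atTop (H : HasTailIndex U V c γ) (hU : Tendsto U atTop atTop) :
    Tendsto (fun s => V s / U s) atTop (𝓝 γ) := by
  have h : Tendsto (fun s => (V s - γ * U s) / U s) atTop (𝓝 0) := by
    rw [Metric.tendsto_nhds]
    intro ε hε
    obtain ⟨S, hS⟩ := (H.abs_sub_le (half_pos hε)).exists
    have hlim : Tendsto (fun s => (|V S - γ * U S| + ε / 2 * |U S|) / U s) atTop (𝓝 0) :=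
      tendsto_const_nhds.div_atTop hU
    filter_upwards [eventually_ge_atTop S, hU.eventually_gt_atTop 0,
      hlim.eventually_lt_const (half_pos hε)] with s hs hpos hlt
    rw [Real.dist_eq, sub_zero, abs_div, abs_of_pos hpos, div_lt_iff₀ hpos]
    rw [div_lt_iff₀ hpos] at hlt
    have h1 := hS s hs
    have h2 := abs_sub_abs_le_abs_sub (V s - γ * U s) (V S - γ * U S)
    have h3 := neg_abs_le (U S)
    nlinarith
  have := h.add_const γ
  rw [zero_add] at this
  refine this.congr' ?_
  filter_upwards [hU.eventually_gt_atTop 0] with s hs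
  field_simp
  ring

/-- The unit increments of U vanish, and they are equivalent to a nonzero multiple of V. -/
lemma tendsto_deriv_zero (H : HasTailIndex U V c γ) {e : ℝ} (hU : Tendsto U atTop (𝓝 e)) :
    Tendsto V atTop (𝓝 0) := by
  have h1 := H.tendsto_increment one_pos
  have h2 : Tendsto (fun s => U (s + 1) - U s) atTop (𝓝 0) := by
    simpa using (hU.comp (tendsto_atTop_add_const_right _ 1 tendsto_id)).sub hU
  have hne : primK γ (Real.exp 1) ≠ 0 := by
    have := strictMono_primK_exp γ one_pos
    simp only [Real.exp_zero, primK_one] at this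
    exact this.ne'
  have h3 := h2.div h1 hne
  rw [zero_div] at h3
  refine h3.congr' ?_
  have h4 : ∀ᶠ s in atTop, (U (s + 1) - U s) / V s ≠ 0 := h1.eventually_ne hne
  filter_upwards [H.pos, h4] with s hs h5
  have : U (s + 1) - U s ≠ 0 := fun h => h5 (by simp [h])
  simp only [Pi.div_apply]
  field_simp

/-- For γ > 0 the positive function V would eventually be nondecreasing, which is incompatible with
V → 0. -/
lemma nonpos_of_tendsto (H : HasTailIndex U V c γ) {e : ℝ} (hU : Tendsto U atTop (𝓝 e)) :
    γ ≤ 0 := by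
  by_contra! hγ
  obtain ⟨S, hS⟩ := eventually_atTop.1 (H.pos.and (H.deriv_snd.and
    (H.tendsto.eventually_const_lt hγ)))
  have hmono : MonotoneOn V (Ici S) :=
    monotoneOn_of_hasDerivWithinAt_nonneg (convex_Ici S)
      (fun u hu => (hS u hu).2.1.continuousAt.continuousWithinAt)
      (fun u hu => (hS u (interior_subset hu)).2.1.hasDerivWithinAt) fun u hu => by
        obtain ⟨h1, -, h3⟩ := hS u (interior_subset hu)
        positivity
  have : V S ≤ 0 := ge_of_tendsto (H.tendsto_deriv_zero hU)
    ((eventually_ge_atTop S).mono fun s hs => hmono self_mem_Ici hs hs)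
  linarith [(hS S le_rfl).1]

lemma tendsto_div_of_nhds (H : HasTailIndex U V c γ) {e : ℝ} (hU : Tendsto U atTop (𝓝 e))
    (hlt : ∀ᶠ s in atTop, U s < e) (he : γ < 0 → e ≠ 0) :
    Tendsto (fun s => V s / U s) atTop (𝓝 0) := by
  have hV := H.tendsto_deriv_zero hU
  by_cases h0 : e = 0
  -- A zero endpoint makes V/U an indeterminate 0/0. It can only occur with γ = 0, where letting s →
  -- ∞ in `abs_sub_le` gives V(S) ≤ (ε/2)|U(S)|.
  · have hγ : γ = 0 := le_antisymm (H.nonpos_of_tendsto hU) (not_lt.1 fun h => he h h0)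
    subst h0 hγ
    rw [Metric.tendsto_nhds]
    intro ε hε
    filter_upwards [H.abs_sub_le (half_pos hε), hlt] with S hS hneg
    have h1 : |(0 - 0 * 0) - (V S - 0 * U S)| ≤ ε / 2 * (0 - U S) :=
      le_of_tendsto_of_tendsto ((hV.sub (hU.const_mul 0)).sub_const _).abs
        ((hU.sub_const _).const_mul _) ((eventually_ge_atTop S).mono hS)
    simp only [mul_zero, sub_zero, zero_mul, zero_sub, abs_neg] at h1
    rw [Real.dist_eq, sub_zero, abs_div, abs_of_neg hneg, div_lt_iff₀ (by linarith)]
    nlinarith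
  · have := hV.div hU h0
    rwa [zero_div] at this

/-- V/U is the logarithmic derivative of U, or of -U when U is negative. -/
lemma tendsto_ratio_of_tendsto_div (H : HasTailIndex U V c γ) {m w : ℝ}
    (hdiv : Tendsto (fun s => V s / U s) atTop (𝓝 m))
    (hsign : (∀ᶠ s in atTop, 0 < U s) ∨ ∀ᶠ s in atTop, U s < 0) :
    Tendsto (fun s => U (s + w) / U s) atTop (𝓝 (Real.exp (m * w))) := by
  rcases hsign with hpos | hneg
  · refine tendsto_ratio (c := fun s => V s / U s) hpos ?_ hdiv tendsto_id tendsto_const_nhds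
    filter_upwards [H.deriv_fst, hpos] with s hs hp
    rwa [div_mul_cancel₀ _ hp.ne']
  · have := tendsto_ratio (f := fun s => -U s) (c := fun s => V s / U s) (hneg.mono fun s hs => by
      simpa using hs) ?_ hdiv tendsto_id (tendsto_const_nhds (x := w))
    · simpa using this
    · filter_upwards [H.deriv_fst, hneg] with s hs hp
      convert! hs.neg using 1
      field_simp [hp.ne]

end HasTailIndex

/-! ### Quantiles of a continuous survival function -/

/-- `G` is a continuous survival function. -/
structure IsContSurvival (G : ℝ → ℝ) : Prop where
  antitone : Antitone G
  continuous : Continuous G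
  limit_atTop : Tendsto G atTop (𝓝 0)
  limit_atBot : Tendsto G atBot (𝓝 1)

namespace IsContSurvival

lemma endpoint_ne_bot {G : ℝ → ℝ} (hG : IsContSurvival G) : endpoint G ≠ ⊥ :=
  ExtremeQuantile.endpoint_ne_bot hG.antitone hG.continuous hG.limit_atBot

lemma pos_iff {G : ℝ → ℝ} (hG : IsContSurvival G) {t : ℝ} : 0 < G t ↔ (t : EReal) < endpoint G :=
  pos_iff_lt_endpoint hG.antitone hG.continuous

lemma genInv_le_iff {G : ℝ → ℝ} (hG : IsContSurvival G)
    {β : ℝ} (hβ : 0 < β) (hβ1 : β < 1) {t : ℝ} : genInv G β ≤ t ↔ G t ≤ β :=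
  ExtremeQuantile.genInv_le_iff hG.antitone (fun _ => hG.continuous.continuousWithinAt)
    ((hG.limit_atTop.eventually_le_const hβ).exists)
    ((hG.limit_atBot.eventually_const_lt hβ1).exists)

lemma le_one {G : ℝ → ℝ} (hG : IsContSurvival G) (t : ℝ) : G t ≤ 1 :=
  ge_of_tendsto hG.limit_atBot ((eventually_le_atBot t).mono fun _ hs => hG.antitone hs)

lemma apply_genInv {G : ℝ → ℝ} (hG : IsContSurvival G)
    {β : ℝ} (hβ : 0 < β) (hβ1 : β < 1) : G (genInv G β) = β := by
  refine le_antisymm ((hG.genInv_le_iff hβ hβ1).1 le_rfl) ?_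
  by_contra! hlt
  have hev : ∀ᶠ u in 𝓝[<] (genInv G β), G u < β :=
    (hG.continuous.continuousAt.eventually_lt_const hlt).filter_mono nhdsWithin_le_nhds
  obtain ⟨u, hu, hul⟩ := (hev.and self_mem_nhdsWithin).exists
  exact absurd ((hG.genInv_le_iff hβ hβ1).2 hu.le) (not_le.2 hul)

lemma lt_genInv {G : ℝ → ℝ} (hG : IsContSurvival G)
    {β y : ℝ} (hβ : 0 < β) (hβ1 : β < G y) : y < genInv G β := by
  rw [← not_le, hG.genInv_le_iff hβ (hβ1.trans_le (hG.le_one y)), not_le]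
  exact hβ1

lemma genInv_lt_endpoint {G : ℝ → ℝ} (hG : IsContSurvival G) {β : ℝ} (hβ : 0 < β) (hβ1 : β < 1) :
    (genInv G β : EReal) < endpoint G := by
  rw [← hG.pos_iff, hG.apply_genInv hβ hβ1]
  exact hβ

lemma tendsto_quantile_exp {G : ℝ → ℝ} (hG : IsContSurvival G) :
    Tendsto (fun s => genInv G (Real.exp (-s))) atTop (upTo (endpoint G)) := by
  intro A hA
  rw [mem_map]
  obtain ⟨y₀, hy₀, H⟩ := (eventually_upTo hG.endpoint_ne_bot).1 hA
  have h0 : Tendsto (fun s : ℝ => Real.exp (-s)) atTop (𝓝 0) :=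
    Real.tendsto_exp_neg_atTop_nhds_zero
  filter_upwards [h0.eventually_lt_const (hG.pos_iff.2 hy₀)] with s hs
  have h1 := hs.trans_le (hG.le_one y₀)
  exact H _ (hG.lt_genInv (Real.exp_pos _) hs) (hG.genInv_lt_endpoint (Real.exp_pos _) h1)

lemma exists_regular {G : ℝ → ℝ} (hG : IsContSurvival G)
    {γ : ℝ} (hV : VonMises G γ) : ∃ y₀ : ℝ, (y₀ : EReal) < endpoint G ∧
    ∀ y : ℝ, y₀ < y → (y : EReal) < endpoint G → HasDerivAt G (deriv G y) y ∧
      HasDerivAt (deriv G) (deriv (deriv G) y) y ∧ deriv G y < 0 := by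
  have hev := hV.differentiable.and (hV.twice_differentiable.and hV.deriv_ne_zero)
  obtain ⟨y₀, hy₀, H⟩ := (eventually_upTo hG.endpoint_ne_bot).1 hev
  refine ⟨y₀, hy₀, fun y h1 h2 => ?_⟩
  obtain ⟨a1, a2, a3⟩ := H y h1 h2
  exact ⟨a1.hasDerivAt, a2.hasDerivAt, lt_of_le_of_ne hG.antitone.deriv_nonpos a3⟩

/-- The function s ↦ q(e^{-s}) inverts y ↦ -log G(y) near the endpoint. Differentiating the inverse
once gives -G/G', and once more gives the von Mises ratio minus 1. -/
lemma hasTailIndex {G : ℝ → ℝ} (hG : IsContSurvival G) {γ : ℝ} (hV : VonMises G γ) :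
    HasTailIndex (fun s => genInv G (Real.exp (-s)))
      (fun s => -G (genInv G (Real.exp (-s))) / deriv G (genInv G (Real.exp (-s))))
      (fun s => G (genInv G (Real.exp (-s))) * deriv (deriv G) (genInv G (Real.exp (-s))) /
        (deriv G (genInv G (Real.exp (-s)))) ^ 2 - 1) γ := by
  obtain ⟨y₀, hy₀, H⟩ := hG.exists_regular hV
  set U : ℝ → ℝ := fun s => genInv G (Real.exp (-s)) with hU
  -- Beyond this threshold `U` takes its values in the interval where `G` is regular.
  set s₀ : ℝ := -Real.log (G y₀) with hs₀
  have hG0 : 0 < G y₀ := hG.pos_iff.2 hy₀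
  have hlt : ∀ s, s₀ < s → Real.exp (-s) < G y₀ := fun s hs => by
    rw [← Real.lt_log_iff_exp_lt hG0]; linarith
  have hlt1 : ∀ s, s₀ < s → Real.exp (-s) < 1 := fun s hs => (hlt s hs).trans_le (hG.le_one y₀)
  have hUgt : ∀ s, s₀ < s → y₀ < U s := fun s hs => hG.lt_genInv (Real.exp_pos _) (hlt s hs)
  have hUe : ∀ s, s₀ < s → (U s : EReal) < endpoint G := fun s hs =>
    hG.genInv_lt_endpoint (Real.exp_pos _) (hlt1 s hs)
  have hGU : ∀ s, s₀ < s → G (U s) = Real.exp (-s) := fun s hs =>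
    hG.apply_genInv (Real.exp_pos _) (hlt1 s hs)
  have hstrict : ∀ y z : ℝ, y₀ ≤ y → y < z → (z : EReal) < endpoint G → G z < G y := by
    intro y z h1 h2 h3
    obtain ⟨ξ, hξ, he⟩ := exists_hasDerivAt_eq_slope G (deriv G) h2
      hG.continuous.continuousOn (fun u hu => (H u (h1.trans_lt hu.1)
        (lt_trans (EReal.coe_lt_coe_iff.2 hu.2) h3)).1)
    have hneg := (H ξ (h1.trans_lt hξ.1) (lt_trans (EReal.coe_lt_coe_iff.2 hξ.2) h3)).2.2
    rw [he, div_neg_iff] at hneg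
    rcases hneg with h | h
    · linarith [h.2]
    · linarith [h.1]
  have hUmono : MonotoneOn U (Ioi s₀) := by
    intro s hs t ht hst
    refine (hG.genInv_le_iff (Real.exp_pos _) (hlt1 s hs)).2 ?_
    rw [hGU t ht]
    exact Real.exp_le_exp.2 (by linarith)
  have himage : ∀ y : ℝ, y₀ < y → (y : EReal) < endpoint G →
      s₀ < -Real.log (G y) ∧ U (-Real.log (G y)) = y := by
    intro y h1 h2
    have hp : 0 < G y := hG.pos_iff.2 h2
    have hs : s₀ < -Real.log (G y) := by
      have := Real.log_lt_log hp (hstrict y₀ y le_rfl h1 h2)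
      linarith
    refine ⟨hs, ?_⟩
    have he : G (U (-Real.log (G y))) = G y := by
      rw [hGU _ hs, neg_neg, Real.exp_log hp]
    rcases lt_trichotomy (U (-Real.log (G y))) y with h | h | h
    · exact absurd he (hstrict _ _ (hUgt _ hs).le h h2).ne'
    · exact h
    · exact absurd he (hstrict _ _ h1.le h (hUe _ hs)).ne
  -- The inverse function rule needs continuity first: `U` is monotone and its image contains a
  -- neighbourhood of each of its values.
  have hUcont : ∀ s, s₀ < s → ContinuousAt U s := by
    intro s hs
    refine continuousAt_of_monotoneOn_of_image_mem_nhds hUmono (Ioi_mem_nhds hs) ?_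
    have hopen : {y : ℝ | y₀ < y ∧ (y : EReal) < endpoint G} ∈ 𝓝 (U s) :=
      ((isOpen_Ioi (a := y₀)).inter ((isOpen_Iio (a := endpoint G)).preimage
        continuous_coe_real_ereal)).mem_nhds ⟨hUgt s hs, hUe s hs⟩
    filter_upwards [hopen] with y hy
    obtain ⟨h1, h2⟩ := himage y hy.1 hy.2
    exact ⟨_, h1, h2⟩
  have hUder : ∀ s, s₀ < s → HasDerivAt U (-G (U s) / deriv G (U s)) s := by
    intro s hs
    obtain ⟨d1, -, d3⟩ := H (U s) (hUgt s hs) (hUe s hs)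
    have hp : 0 < G (U s) := hG.pos_iff.2 (hUe s hs)
    have hd : HasDerivAt (fun y => -Real.log (G y)) (-(deriv G (U s) / G (U s))) (U s) :=
      (d1.log hp.ne').neg
    have := HasDerivAt.of_local_left_inverse (hUcont s hs) hd
      (neg_ne_zero.2 (div_ne_zero d3.ne hp.ne')) (by
        filter_upwards [Ioi_mem_nhds hs] with t ht
        rw [hGU t ht, Real.log_exp, neg_neg])
    convert! this using 1
    rw [inv_neg, inv_div, neg_div]
  refine ⟨?_, ?_, ?_, ?_⟩
  · filter_upwards [eventually_gt_atTop s₀] with s hs using hUder s hs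
  · filter_upwards [eventually_gt_atTop s₀] with s hs
    exact div_pos_of_neg_of_neg (neg_lt_zero.2 (hG.pos_iff.2 (hUe s hs)))
      (H (U s) (hUgt s hs) (hUe s hs)).2.2
  · filter_upwards [eventually_gt_atTop s₀] with s hs
    obtain ⟨d1, d2, d3⟩ := H (U s) (hUgt s hs) (hUe s hs)
    have hb := (d1.neg.div d2 d3.ne).comp s (hUder s hs)
    convert! hb using 1
    -- In y, the derivative of -G/G' is GG''/(G')² - 1; the chain rule multiplies it by U' = V.
    change (G (U s) * deriv (deriv G) (U s) / deriv G (U s) ^ 2 - 1) *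
      (-G (U s) / deriv G (U s)) = _
    have := d3.ne
    simp only [Pi.neg_apply]
    field_simp
    ring
  · have := (hV.tendsto.comp hG.tendsto_quantile_exp).sub_const 1
    rwa [add_sub_cancel_right] at this

/-- An infinite endpoint gives the limit γ, which is then nonnegative since V/U > 0. A finite
endpoint forces γ ≤ 0 and gives the limit 0. Both cases read γ ∨ 0. -/
lemma tendsto_deriv_div_quantile {G : ℝ → ℝ} (hG : IsContSurvival G)
    {γ : ℝ} (hV : VonMises G γ) (hend : γ < 0 → endpoint G ≠ 0) :
    Tendsto (fun s => (-G (genInv G (Real.exp (-s))) / deriv G (genInv G (Real.exp (-s)))) /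
      genInv G (Real.exp (-s))) atTop (𝓝 (max γ 0)) ∧
    ((∀ᶠ s in atTop, 0 < genInv G (Real.exp (-s))) ∨
      ∀ᶠ s in atTop, genInv G (Real.exp (-s)) < 0) := by
  have H := hG.hasTailIndex hV
  have hU := hG.tendsto_quantile_exp
  rcases eq_or_ne (endpoint G) ⊤ with htop | htop
  · have hU' : Tendsto (fun s => genInv G (Real.exp (-s))) atTop atTop := by
      refine tendsto_atTop.2 fun M => ?_
      filter_upwards [hU.eventually ((eventually_upTo hG.endpoint_ne_bot).2
        ⟨M, by rw [htop]; exact EReal.coe_lt_top M, fun y hy _ => hy.le⟩)] with s hs using hs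
    have hpos := hU'.eventually_gt_atTop 0
    have h := H.tendsto_div_of_atTop hU'
    have hγ : 0 ≤ γ := ge_of_tendsto h (by
      filter_upwards [hpos, H.pos] with s h1 h2 using (div_pos h2 h1).le)
    rw [max_eq_left hγ]
    exact ⟨h, Or.inl hpos⟩
  · obtain ⟨e, he⟩ : ∃ e : ℝ, (e : EReal) = endpoint G :=
      ⟨_, EReal.coe_toReal htop hG.endpoint_ne_bot⟩
    have hlt : ∀ᶠ s in atTop, genInv G (Real.exp (-s)) < e := by
      filter_upwards [hU.eventually ((eventually_upTo hG.endpoint_ne_bot).2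
        ⟨e - 1, by rw [← he]; exact EReal.coe_lt_coe_iff.2 (by linarith), fun y _ hy => by
          rw [← he] at hy; exact EReal.coe_lt_coe_iff.1 hy⟩)] with s hs using hs
    have hU' : Tendsto (fun s => genInv G (Real.exp (-s))) atTop (𝓝 e) := by
      refine tendsto_order.2 ⟨fun M hM => ?_, fun M hM => hlt.mono fun s hs => hs.trans hM⟩
      filter_upwards [hU.eventually ((eventually_upTo hG.endpoint_ne_bot).2
        ⟨M, by rw [← he]; exact EReal.coe_lt_coe_iff.2 hM, fun y hy _ => hy⟩)] with s hs using hs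
    have hγ := H.nonpos_of_tendsto hU'
    rw [max_eq_right hγ]
    refine ⟨H.tendsto_div_of_nhds hU' hlt fun h h0 => hend h ?_, ?_⟩
    · rw [← he, h0]; rfl
    · rcases le_or_gt e 0 with h0 | h0
      · exact Or.inr (hlt.mono fun s hs => hs.trans_le h0)
      · exact Or.inl (hU'.eventually_const_lt h0)

/-- A single test value u = e is enough: it places U + K_γ(e) a(U) between U(s+w) for w slightly
below 1 and for w slightly above 1, and these increments are known in units of V. -/
lemma tendsto_auxiliary_div {G : ℝ → ℝ} (hG : IsContSurvival G)
    {γ : ℝ} (hV : VonMises G γ) {a : ℝ → ℝ} (ha : IsAuxiliary G γ a) :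
    Tendsto (fun s => a (genInv G (Real.exp (-s))) /
      (-G (genInv G (Real.exp (-s))) / deriv G (genInv G (Real.exp (-s))))) atTop (𝓝 1) := by
  have H := hG.hasTailIndex hV
  set U : ℝ → ℝ := fun s => genInv G (Real.exp (-s)) with hU
  set V : ℝ → ℝ := fun s => -G (U s) / deriv G (U s) with hVdef
  set E : ℝ → ℝ := fun w => primK γ (Real.exp w) with hE
  have hEpos : 0 < E 1 := by
    have := strictMono_primK_exp γ one_pos
    simpa only [Real.exp_zero, primK_one] using this
  have hEcont : ContinuousAt E 1 := (hasDerivAt_primK_exp γ 1).continuousAt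
  have hlim : Tendsto (fun s => G (U s + E 1 * a (U s)) / G (U s)) atTop (𝓝 (Real.exp (-1))) := by
    have := (ha.tendsto (Real.exp 1) (Real.exp_pos 1)).comp hG.tendsto_quantile_exp
    rwa [one_div, ← Real.exp_neg] at this
  have hsmall : ∀ᶠ s : ℝ in atTop, Real.exp (-s) < 1 :=
    Real.tendsto_exp_neg_atTop_nhds_zero.eventually_lt_const one_pos
  have hcmp : ∀ w, 0 < w → ∀ᶠ s in atTop,
      (U (s + w) ≤ U s + E 1 * a (U s) ↔
        G (U s + E 1 * a (U s)) / G (U s) ≤ Real.exp (-w)) := by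
    intro w hw
    filter_upwards [hsmall] with s hs
    have hs' : Real.exp (-(s + w)) < 1 := lt_of_le_of_lt (Real.exp_le_exp.2 (by linarith)) hs
    rw [hG.genInv_le_iff (Real.exp_pos _) hs', hG.apply_genInv (Real.exp_pos _) hs,
      div_le_iff₀ (Real.exp_pos _), ← Real.exp_add, show -(s + w) = -w + -s by ring]
  refine tendsto_order.2 ⟨fun x hx => ?_, fun x hx => ?_⟩
  -- Continuity of E at 1 and x < 1 leave room for some w < 1; the other half is symmetric.
  · have hc : ∀ᶠ w in 𝓝[<] (1 : ℝ), x * E 1 < E w := by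
      refine (hEcont.eventually_const_lt ?_).filter_mono nhdsWithin_le_nhds
      nlinarith
    have hc2 : ∀ᶠ w in 𝓝[<] (1 : ℝ), 0 < w :=
      (eventually_gt_nhds one_pos).filter_mono nhdsWithin_le_nhds
    obtain ⟨w, ⟨hw, hw0⟩, hw1⟩ := ((hc.and hc2).and self_mem_nhdsWithin).exists
    filter_upwards [hcmp w hw0, H.pos, (H.tendsto_increment hw0).eventually_const_lt hw,
      hlim.eventually_lt_const (Real.exp_lt_exp.2 (neg_lt_neg (mem_Iio.1 hw1)))] with s h1 h2 h3 h4
    have h5 := h1.2 h4.le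
    rw [lt_div_iff₀ h2] at h3 ⊢
    change x * E 1 * V s < U (s + w) - U s at h3
    refine lt_of_mul_lt_mul_left ?_ hEpos.le
    change E 1 * (x * V s) < E 1 * a (U s)
    linarith
  · have hc : ∀ᶠ w in 𝓝[>] (1 : ℝ), E w < x * E 1 := by
      refine (hEcont.eventually_lt_const ?_).filter_mono nhdsWithin_le_nhds
      nlinarith
    obtain ⟨w, hw, hw1⟩ := (hc.and self_mem_nhdsWithin).exists
    have hw0 : 0 < w := one_pos.trans hw1
    filter_upwards [hcmp w hw0, H.pos, (H.tendsto_increment hw0).eventually_lt_const hw,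
      hlim.eventually_const_lt (Real.exp_lt_exp.2 (neg_lt_neg (mem_Ioi.1 hw1)))] with s h1 h2 h3 h4
    have h5 := mt h1.1 (not_le.2 h4)
    rw [not_le] at h5
    rw [div_lt_iff₀ h2] at h3 ⊢
    change U (s + w) - U s < x * E 1 * V s at h3
    refine lt_of_mul_lt_mul_left ?_ hEpos.le
    change E 1 * a (U s) < E 1 * (x * V s)
    linarith

/-- With s = -log α and w = -log τ, the expression is the product of σ(U(s+w+v/σ) - U(s+w))/V(s+w),
V(s+w)/V(s), V(s)/a(U(s)) and U(s)/U(s+w). The second conclusion is what preserves the direction of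
inequalities when quantiles are negative. -/
lemma tendsto_quantile_increment {G : ℝ → ℝ} (hG : IsContSurvival G)
    {γ : ℝ} (hV : VonMises G γ) (hend : γ < 0 → endpoint G ≠ 0)
    {a : ℝ → ℝ} (ha : IsAuxiliary G γ a) {ι : Type*} {l : Filter ι} {α σ : ι → ℝ}
    (hα : Tendsto α l (𝓝 0)) (hα0 : ∀ᶠ i in l, 0 < α i) (hσ : Tendsto σ l atTop)
    {τ : ℝ} (hτ : 0 < τ) (v : ℝ) :
    Tendsto (fun i => σ i * (genInv G (α i) / a (genInv G (α i))) *
      (genInv G (τ * α i * Real.exp (-(v / σ i))) / genInv G (τ * α i) - 1)) l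
      (𝓝 (v * τ ^ (-(min γ 0)))) ∧
    ∀ᶠ i in l, 0 < genInv G (α i) / a (genInv G (α i)) / genInv G (τ * α i) := by
  have H := hG.hasTailIndex hV
  obtain ⟨hdiv, hsign⟩ := hG.tendsto_deriv_div_quantile hV hend
  have haux := hG.tendsto_auxiliary_div hV ha
  set U : ℝ → ℝ := fun s => genInv G (Real.exp (-s)) with hU
  set V : ℝ → ℝ := fun s => -G (U s) / deriv G (U s) with hVdef
  set w : ℝ := -Real.log τ with hw
  set s : ι → ℝ := fun i => -Real.log (α i) with hs
  have hs_lim : Tendsto s l atTop := by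
    refine tendsto_neg_atBot_atTop.comp (Real.tendsto_log_nhdsGT_zero.comp ?_)
    exact tendsto_nhdsWithin_iff.2 ⟨hα, hα0⟩
  have hsw_lim : Tendsto (fun i => s i + w) l atTop := tendsto_atTop_add_const_right _ _ hs_lim
  have hvσ : Tendsto (fun i => v / σ i) l (𝓝 0) := tendsto_const_nhds.div_atTop hσ
  have hincr : Tendsto (fun i => σ i * (U (s i + w + v / σ i) - U (s i + w)) / V (s i + w)) l
      (𝓝 v) := by
    refine H.tendsto_mul_increment hsw_lim hvσ ?_
    refine tendsto_const_nhds.congr' ?_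
    filter_upwards [hσ.eventually_gt_atTop 0] with i hi
    field_simp
  have hVr : Tendsto (fun i => V (s i + w) / V (s i)) l (𝓝 (Real.exp (γ * w))) :=
    tendsto_ratio H.pos H.deriv_snd H.tendsto hs_lim tendsto_const_nhds
  have hUr : Tendsto (fun i => U (s i + w) / U (s i)) l (𝓝 (Real.exp (max γ 0 * w))) :=
    (H.tendsto_ratio_of_tendsto_div hdiv hsign).comp hs_lim
  have har : Tendsto (fun i => a (U (s i)) / V (s i)) l (𝓝 1) := haux.comp hs_lim
  have hUs : ∀ᶠ i in l, U (s i) = genInv G (α i) := by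
    filter_upwards [hα0] with i hi
    simp only [hU, hs, neg_neg, Real.exp_log hi]
  have hUsw : ∀ᶠ i in l, U (s i + w) = genInv G (τ * α i) := by
    filter_upwards [hα0] with i hi
    simp only [hU, hs, hw]
    rw [show -(-Real.log (α i) + -Real.log τ) = Real.log τ + Real.log (α i) by ring,
      Real.exp_add, Real.exp_log hi, Real.exp_log hτ]
  have hUswv : ∀ᶠ i in l, U (s i + w + v / σ i) = genInv G (τ * α i * Real.exp (-(v / σ i))) := by
    filter_upwards [hα0] with i hi
    simp only [hU, hs, hw]
    rw [show -(-Real.log (α i) + -Real.log τ + v / σ i) =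
      Real.log τ + Real.log (α i) + -(v / σ i) by ring,
      Real.exp_add, Real.exp_add, Real.exp_log hi, Real.exp_log hτ]
  have hVs : ∀ᶠ i in l, 0 < V (s i) := hs_lim.eventually H.pos
  have hVsw : ∀ᶠ i in l, 0 < V (s i + w) := hsw_lim.eventually H.pos
  have hapos : ∀ᶠ i in l, 0 < a (U (s i)) / V (s i) := har.eventually_const_lt one_pos
  have hUpos : ∀ᶠ i in l, 0 < U (s i + w) / U (s i) :=
    hUr.eventually_const_lt (Real.exp_pos _)
  constructor
  · have key := ((hincr.mul hVr).mul (har.inv₀ one_ne_zero)).mul (hUr.inv₀ (Real.exp_pos _).ne')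
    have hval : v * Real.exp (γ * w) * (1 : ℝ)⁻¹ * (Real.exp (max γ 0 * w))⁻¹ =
        v * τ ^ (-(min γ 0)) := by
      rw [← Real.exp_neg, inv_one, mul_one, mul_assoc, ← Real.exp_add, Real.rpow_def_of_pos hτ]
      congr 2
      have h2 : max γ 0 = γ - min γ 0 := by linarith [min_add_max γ 0]
      rw [h2]
      simp only [hw]
      ring
    rw [hval] at key
    refine key.congr' ?_
    filter_upwards [hUs, hUsw, hUswv, hVs, hVsw, hapos, hUpos] with i h1 h2 h3 h4 h5 h6 h7
    rw [← h1, ← h2, ← h3]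
    have n1 : U (s i) ≠ 0 := fun h => by simp [h] at h7
    have n2 : U (s i + w) ≠ 0 := fun h => by simp [h] at h7
    have n3 : a (U (s i)) ≠ 0 := fun h => by simp [h] at h6
    field_simp
  · filter_upwards [hUs, hUsw, hVs, hapos, hUpos] with i h1 h2 h4 h6 h7
    rw [← h1, ← h2]
    have n3 : 0 < a (U (s i)) := by
      have := mul_pos h6 h4
      rwa [div_mul_cancel₀ _ h4.ne'] at this
    have := inv_pos.2 h7
    rw [inv_div] at this
    rw [div_div, mul_comm, ← div_div]
    exact div_pos this n3

end IsContSurvival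

/-! ### Row sums of functions of independent copies -/

section RowSums

variable {Ω E : Type*} [MeasurableSpace Ω] [MeasurableSpace E] {P : Measure Ω}
  [IsProbabilityMeasure P] {ν : Measure E} {V : ℕ → Ω → E}

lemma integrable_of_abs_le {ν : Measure E} [IsProbabilityMeasure ν] {f : E → ℝ}
    (hf : Measurable f) {B : ℝ} (hB : ∀ e, |f e| ≤ B) : Integrable f ν :=
  Integrable.of_bound hf.aestronglyMeasurable B (ae_of_all _ hB)

/-- Variance plus squared bias about an arbitrary centre, the variance of each term being bounded by
its second moment. -/
lemma integral_sum_sub_sq_le (hV : ∀ i, Measurable (V i)) (hind : iIndepFun V P)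
    (hlaw : ∀ i, P.map (V i) = ν) {f : E → ℝ} (hf : Measurable f) {B : ℝ}
    (hB : ∀ e, |f e| ≤ B) (n : ℕ) (m : ℝ) :
    ∫ ω, (∑ i ∈ Finset.range n, f (V i ω) - m) ^ 2 ∂P ≤
      n * ∫ e, f e ^ 2 ∂ν + (n * ∫ e, f e ∂ν - m) ^ 2 := by
  have hLp : ∀ i, MemLp (fun ω => f (V i ω)) 2 P := fun i =>
    MemLp.of_bound (hf.comp (hV i)).aestronglyMeasurable B (ae_of_all _ fun ω => hB _)
  have hint : ∀ i, ∫ ω, f (V i ω) ∂P = ∫ e, f e ∂ν := fun i => by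
    rw [← hlaw i, integral_map (hV i).aemeasurable hf.aestronglyMeasurable]
  have hsq : ∀ i, ∫ ω, f (V i ω) ^ 2 ∂P = ∫ e, f e ^ 2 ∂ν := fun i => by
    rw [← hlaw i, integral_map (hV i).aemeasurable (hf.pow_const 2).aestronglyMeasurable]
  have hsum : MemLp (fun ω => ∑ i ∈ Finset.range n, f (V i ω)) 2 P :=
    memLp_finsetSum _ fun i _ => hLp i
  have hmean : ∫ ω, ∑ i ∈ Finset.range n, f (V i ω) ∂P = n * ∫ e, f e ∂ν := by
    rw [integral_finsetSum _ fun i _ => (hLp i).integrable one_le_two]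
    simp [hint]
  have hvar : Var[fun ω => ∑ i ∈ Finset.range n, f (V i ω); P] ≤ n * ∫ e, f e ^ 2 ∂ν := by
    have h1 := IndepFun.variance_sum (μ := P) (X := fun i ω => f (V i ω)) (s := Finset.range n)
      (fun i _ => hLp i) (fun i _ j _ hij => (hind.indepFun hij).comp hf hf)
    have h2 : (∑ i ∈ Finset.range n, fun ω => f (V i ω)) =
        fun ω => ∑ i ∈ Finset.range n, f (V i ω) := by
      ext ω; simp
    rw [h2] at h1
    rw [h1]
    calc _ ≤ ∑ i ∈ Finset.range n, ∫ e, f e ^ 2 ∂ν := by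
          refine Finset.sum_le_sum fun i _ => ?_
          rw [← hsq i]
          exact variance_le_expectation_sq (hLp i).aestronglyMeasurable
      _ = _ := by simp
  have hsub : MemLp (fun ω => ∑ i ∈ Finset.range n, f (V i ω) - m) 2 P :=
    hsum.sub (memLp_const m)
  have hdecomp := variance_eq_sub hsub
  rw [variance_sub_const hsum.aestronglyMeasurable m,
    integral_sub (hsum.integrable one_le_two) (integrable_const m), hmean] at hdecomp
  simp only [Pi.pow_apply, integral_const, probReal_univ, one_smul] at hdecomp
  linarith

lemma measureReal_sum_sub_ge_le (hV : ∀ i, Measurable (V i)) (hind : iIndepFun V P)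
    (hlaw : ∀ i, P.map (V i) = ν) {f : E → ℝ} (hf : Measurable f) {B : ℝ}
    (hB : ∀ e, |f e| ≤ B) (n : ℕ) (m : ℝ) {ε : ℝ} (hε : 0 < ε) :
    P.real {ω | ε ≤ |∑ i ∈ Finset.range n, f (V i ω) - m|} ≤
      (n * ∫ e, f e ^ 2 ∂ν + (n * ∫ e, f e ∂ν - m) ^ 2) / ε ^ 2 := by
  have hLp : ∀ i, MemLp (fun ω => f (V i ω)) 2 P := fun i =>
    MemLp.of_bound (hf.comp (hV i)).aestronglyMeasurable B (ae_of_all _ fun ω => hB _)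
  have hsum0 : MemLp (fun ω => ∑ i ∈ Finset.range n, f (V i ω)) 2 P :=
    memLp_finsetSum _ fun i _ => hLp i
  have hsum : MemLp (fun ω => ∑ i ∈ Finset.range n, f (V i ω) - m) 2 P :=
    hsum0.sub (memLp_const m)
  have h := mul_meas_ge_le_integral_of_nonneg (μ := P)
    (f := fun ω => (∑ i ∈ Finset.range n, f (V i ω) - m) ^ 2)
    (ae_of_all _ fun ω => sq_nonneg _) hsum.integrable_sq (ε ^ 2)
  have hset : {ω | ε ≤ |∑ i ∈ Finset.range n, f (V i ω) - m|} =
      {ω | ε ^ 2 ≤ (∑ i ∈ Finset.range n, f (V i ω) - m) ^ 2} := by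
    ext ω
    simp only [mem_ofPred_eq]
    rw [sq_le_sq, abs_of_pos hε]
  rw [hset, le_div_iff₀ (by positivity), mul_comm]
  exact h.trans (integral_sum_sub_sq_le hV hind hlaw hf hB n m)

lemma tendsto_measureReal_sum_sub_ge (hV : ∀ i, Measurable (V i)) (hind : iIndepFun V P)
    (hlaw : ∀ i, P.map (V i) = ν) {f : ℕ → E → ℝ} (hf : ∀ n, Measurable (f n)) {B : ℕ → ℝ}
    (hB : ∀ n e, |f n e| ≤ B n) {m : ℝ}
    (h1 : Tendsto (fun n : ℕ => n * ∫ e, f n e ∂ν) atTop (𝓝 m))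
    (h2 : Tendsto (fun n : ℕ => n * ∫ e, f n e ^ 2 ∂ν) atTop (𝓝 0)) {ε : ℝ} (hε : 0 < ε) :
    Tendsto (fun n : ℕ => P.real {ω | ε ≤ |∑ i ∈ Finset.range n, f n (V i ω) - m|})
      atTop (𝓝 0) := by
  have hlim : Tendsto (fun n : ℕ => (n * ∫ e, f n e ^ 2 ∂ν +
      (n * ∫ e, f n e ∂ν - m) ^ 2) / ε ^ 2) atTop (𝓝 0) := by
    have := (h2.add ((h1.sub_const m).pow 2)).div_const (ε ^ 2)
    simpa using this
  exact squeeze_zero (fun n => measureReal_nonneg)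
    (fun n => measureReal_sum_sub_ge_le hV hind hlaw (hf n) (hB n) n m hε) hlim

/-- Tightness by Chebyshev's inequality: the second moment of the row sum converges to `s`, hence is
eventually below s + 1. -/
lemma exists_measureReal_sum_ge_le (hV : ∀ i, Measurable (V i)) (hind : iIndepFun V P)
    (hlaw : ∀ i, P.map (V i) = ν) {f : ℕ → E → ℝ} (hf : ∀ n, Measurable (f n)) {B : ℕ → ℝ}
    (hB : ∀ n e, |f n e| ≤ B n) {s : ℝ}
    (h1 : Tendsto (fun n : ℕ => n * ∫ e, f n e ∂ν) atTop (𝓝 0))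
    (h2 : Tendsto (fun n : ℕ => n * ∫ e, f n e ^ 2 ∂ν) atTop (𝓝 s)) {δ : ℝ} (hδ : 0 < δ) :
    ∃ M : ℝ, ∀ᶠ n : ℕ in atTop,
      P.real {ω | M ≤ |∑ i ∈ Finset.range n, f n (V i ω)|} ≤ δ := by
  have hlim : Tendsto (fun M : ℝ => (s + 1) / M ^ 2) atTop (𝓝 0) :=
    tendsto_const_nhds.div_atTop (tendsto_pow_atTop two_ne_zero)
  obtain ⟨M, hM, hM0⟩ := ((hlim.eventually_le_const hδ).and (eventually_gt_atTop 0)).exists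
  have hlim2 : Tendsto (fun n : ℕ => n * ∫ e, f n e ^ 2 ∂ν +
      (n * ∫ e, f n e ∂ν - 0) ^ 2) atTop (𝓝 s) := by
    simpa using h2.add ((h1.sub_const 0).pow 2)
  refine ⟨M, (hlim2.eventually_le_const (lt_add_one s)).mono fun n hn => ?_⟩
  have := measureReal_sum_sub_ge_le hV hind hlaw (hf n) (hB n) n 0 hM0
  simp only [sub_zero] at this hn
  refine this.trans (le_trans ?_ hM)
  gcongr

/-- A second-order Taylor expansion with remainder |f|³ ≤ B f²; the small bound on `f` replaces a
Lindeberg condition. -/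
lemma norm_integral_exp_sub_le {ν : Measure E} [IsProbabilityMeasure ν] {f : E → ℝ}
    (hf : Measurable f) {B : ℝ} (hB : ∀ e, |f e| ≤ B) (hB1 : B ≤ 1) :
    ‖∫ e, Complex.exp (f e * Complex.I) ∂ν - 1 -
      (((∫ e, f e ∂ν : ℝ) : ℂ) * Complex.I - ((∫ e, f e ^ 2 ∂ν : ℝ) : ℂ) / 2)‖ ≤
      B * ∫ e, f e ^ 2 ∂ν := by
  have hfi := integrable_of_abs_le (ν := ν) hf hB
  have hf2 : Integrable (fun e => f e ^ 2) ν := by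
    refine integrable_of_abs_le (hf.pow_const 2) (B := B ^ 2) fun e => ?_
    rw [abs_pow]
    exact pow_le_pow_left₀ (abs_nonneg _) (hB e) 2
  have hexp : Integrable (fun e => Complex.exp (f e * Complex.I)) ν := by
    refine Integrable.of_bound (by fun_prop) 1 (ae_of_all _ fun e => ?_)
    rw [Complex.norm_exp_ofReal_mul_I]
  have hexp1 : Integrable (fun e => Complex.exp (f e * Complex.I) - 1) ν :=
    hexp.sub (integrable_const 1)
  have hlin : Integrable (fun e => (f e : ℂ) * Complex.I - (f e ^ 2 : ℝ) / 2) ν :=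
    (hfi.ofReal.mul_const _).sub (hf2.ofReal.div_const 2)
  have heq : ∫ e, Complex.exp (f e * Complex.I) ∂ν - 1 -
      (((∫ e, f e ∂ν : ℝ) : ℂ) * Complex.I - ((∫ e, f e ^ 2 ∂ν : ℝ) : ℂ) / 2) =
      ∫ e, (Complex.exp (f e * Complex.I) - 1 -
        ((f e : ℂ) * Complex.I - (f e ^ 2 : ℝ) / 2)) ∂ν := by
    rw [integral_sub hexp1 hlin, integral_sub hexp (integrable_const 1),
      integral_sub (hfi.ofReal.mul_const _) (hf2.ofReal.div_const 2), integral_mul_const,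
      integral_div, integral_complex_ofReal, integral_complex_ofReal]
    simp
  rw [heq, ← integral_const_mul]
  refine norm_integral_le_of_norm_le (hf2.const_mul B) (ae_of_all _ fun e => ?_)
  have hx : ‖(f e : ℂ) * Complex.I‖ = |f e| := by simp
  have hb := Complex.exp_bound (x := (f e : ℂ) * Complex.I) (hx.trans_le ((hB e).trans hB1))
    (n := 3) (by norm_num)
  have hsum : ∑ m ∈ Finset.range 3, ((f e : ℂ) * Complex.I) ^ m / (m.factorial : ℂ) =
      1 + ((f e : ℂ) * Complex.I - (f e ^ 2 : ℝ) / 2) := by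
    simp [Finset.sum_range_succ, Nat.factorial, mul_pow, Complex.I_sq]
    ring
  rw [hsum, hx, ← sub_sub] at hb
  refine hb.trans ?_
  have h0 := abs_nonneg (f e)
  have h3 : |f e| ^ 3 ≤ B * f e ^ 2 := by
    rw [pow_succ, sq_abs, mul_comm]
    exact mul_le_mul_of_nonneg_right (hB e) (sq_nonneg _)
  have hc : ((Nat.succ 3 : ℕ) : ℝ) * (((Nat.factorial 3 : ℕ) : ℝ) * ((3 : ℕ) : ℝ))⁻¹ ≤ 1 := by
    norm_num [Nat.factorial]
  calc _ ≤ |f e| ^ 3 * 1 := by gcongr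
    _ ≤ _ := by linarith

omit [IsProbabilityMeasure P] in
lemma integral_exp_sum (hV : ∀ i, Measurable (V i)) (hind : iIndepFun V P)
    (hlaw : ∀ i, P.map (V i) = ν) {f : E → ℝ} (hf : Measurable f) (n : ℕ) :
    ∫ ω, Complex.exp ((∑ i ∈ Finset.range n, f (V i ω) : ℝ) * Complex.I) ∂P =
      (∫ e, Complex.exp (f e * Complex.I) ∂ν) ^ n := by
  have hm : ∀ i, Measurable fun ω => f (V i ω) := fun i => hf.comp (hV i)
  have hind' : iIndepFun (fun i ω => f (V i ω)) P := hind.comp (fun _ => f) fun _ => hf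
  have h := congrFun ((hind'.restrict (Finset.range n)).charFun_map_fun_finsetSum_eq_prod
    (fun i _ => (hm i).aemeasurable)) 1
  rw [charFun_apply_real, integral_map (by fun_prop) (by fun_prop), Finset.prod_apply] at h
  simp only [charFun_apply_real, Complex.ofReal_one, one_mul] at h
  rw [h]
  have : ∀ i, ∫ x : ℝ, Complex.exp (x * Complex.I) ∂(P.map fun ω => f (V i ω)) =
      ∫ e, Complex.exp (f e * Complex.I) ∂ν := fun i => by
    rw [integral_map (hm i).aemeasurable (by fun_prop), ← hlaw i,
      integral_map (hV i).aemeasurable (by fun_prop)]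
  simp [this]

/-- A central limit theorem, in terms of characteristic functions, for the row sums of a
triangular array of functions of independent copies, with uniformly small entries. -/
lemma tendsto_integral_exp_sum (hV : ∀ i, Measurable (V i)) (hind : iIndepFun V P)
    (hlaw : ∀ i, P.map (V i) = ν) {f : ℕ → E → ℝ} (hf : ∀ n, Measurable (f n)) {B : ℕ → ℝ}
    (hB : ∀ n e, |f n e| ≤ B n) (hB0 : Tendsto B atTop (𝓝 0)) {s : ℝ}
    (h1 : Tendsto (fun n : ℕ => n * ∫ e, f n e ∂ν) atTop (𝓝 0))
    (h2 : Tendsto (fun n : ℕ => n * ∫ e, f n e ^ 2 ∂ν) atTop (𝓝 s)) :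
    Tendsto (fun n : ℕ => ∫ ω,
      Complex.exp ((∑ i ∈ Finset.range n, f n (V i ω) : ℝ) * Complex.I) ∂P)
      atTop (𝓝 (Complex.exp (-(s : ℂ) / 2))) := by
  have : IsProbabilityMeasure ν := by
    rw [← hlaw 0]; exact Measure.isProbabilityMeasure_map (hV 0).aemeasurable
  simp_rw [fun n => integral_exp_sum hV hind hlaw (hf n) n]
  -- The row means need not be zero, only o(1/n), so the linear Taylor term disappears in the limit.
  have hg : Tendsto (fun n : ℕ => (n : ℂ) * (∫ e, Complex.exp (f n e * Complex.I) ∂ν - 1))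
      atTop (𝓝 (-(s : ℂ) / 2)) := by
    have hmain : Tendsto (fun n : ℕ => ((n * ∫ e, f n e ∂ν : ℝ) : ℂ) * Complex.I -
        ((n * ∫ e, f n e ^ 2 ∂ν : ℝ) : ℂ) / 2) atTop (𝓝 (-(s : ℂ) / 2)) := by
      have := (((Complex.continuous_ofReal.tendsto 0).comp h1).mul_const Complex.I).sub
        (((Complex.continuous_ofReal.tendsto s).comp h2).div_const 2)
      simpa [neg_div] using this
    have herr : Tendsto (fun n : ℕ =>
        (n : ℂ) * (∫ e, Complex.exp (f n e * Complex.I) ∂ν - 1) -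
        (((n * ∫ e, f n e ∂ν : ℝ) : ℂ) * Complex.I -
        ((n * ∫ e, f n e ^ 2 ∂ν : ℝ) : ℂ) / 2)) atTop (𝓝 0) := by
      have hlim : Tendsto (fun n : ℕ => B n * (n * ∫ e, f n e ^ 2 ∂ν)) atTop (𝓝 0) := by
        simpa using hB0.mul h2
      refine squeeze_zero_norm' ?_ hlim
      filter_upwards [hB0.eventually_le_const one_pos] with n hn
      have := norm_integral_exp_sub_le (ν := ν) (hf n) (hB n) hn
      have h3 := mul_le_mul_of_nonneg_left this (Nat.cast_nonneg (α := ℝ) n)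
      rw [← Complex.norm_natCast, ← norm_mul, Complex.norm_natCast] at h3
      refine le_trans (le_of_eq ?_) (h3.trans (le_of_eq (by ring)))
      congr 1
      push_cast
      ring
    simpa using herr.add hmain
  simpa using Complex.tendsto_one_add_pow_exp_of_tendsto hg

end RowSums

/-! ### Comparison of a sequence of random variables with an asymptotically linear one -/

/-- If T and W are far apart, a gap between grid points separates them; comparing at a level inside
this gap makes D_n deviate from its limit. Tightness of W makes finitely many gaps suffice. -/
lemma tendstoInMeasure_sub_of_comparison {Ω : Type*} [MeasurableSpace Ω] {P : Measure Ω}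
    [IsProbabilityMeasure P] {T W : ℕ → Ω → ℝ}
    (htight : ∀ δ > 0, ∃ M : ℝ, ∀ᶠ n in atTop, P.real {ω | M ≤ |W n ω|} ≤ δ)
    (hcmp : ∀ v : ℝ, ∃ (z : ℕ → ℝ) (D : ℕ → Ω → ℝ), Tendsto z atTop (𝓝 v) ∧
      (∀ ε > 0, Tendsto (fun n => P.real {ω | ε ≤ |D n ω - v|}) atTop (𝓝 0)) ∧
      Tendsto (fun n => P.real {ω | ¬ (T n ω ≤ z n ↔ W n ω ≤ D n ω)}) atTop (𝓝 0))
    {ε : ℝ} (hε : 0 < ε) : Tendsto (fun n => P.real {ω | ε ≤ |T n ω - W n ω|}) atTop (𝓝 0) := by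
  have hlow : ∀ v η : ℝ, 0 < η →
      Tendsto (fun n => P.real {ω | T n ω ≤ v ∧ v + η ≤ W n ω}) atTop (𝓝 0) := by
    intro v η hη
    obtain ⟨z, D, hz, hD, hbad⟩ := hcmp (v + η / 2)
    have hlim := (hD (η / 2) (half_pos hη)).add hbad
    rw [add_zero] at hlim
    refine squeeze_zero' (Eventually.of_forall fun n => measureReal_nonneg) ?_ hlim
    -- From T ≤ v < z_n the comparison gives W ≤ D_n, so D_n ≥ v + η exceeds its limit by η/2.
    filter_upwards [hz.eventually_const_lt (show v < v + η / 2 by linarith)] with n hn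
    refine (measureReal_mono ?_).trans (measureReal_union_le _ _)
    rintro ω ⟨h1, h2⟩
    by_cases hb : T n ω ≤ z n ↔ W n ω ≤ D n ω
    · left
      have := hb.1 (h1.trans hn.le)
      refine le_trans ?_ (le_abs_self (D n ω - (v + η / 2)))
      linarith
    · exact Or.inr hb
  have hupp : ∀ v η : ℝ, 0 < η →
      Tendsto (fun n => P.real {ω | v + η ≤ T n ω ∧ W n ω ≤ v}) atTop (𝓝 0) := by
    intro v η hη
    obtain ⟨z, D, hz, hD, hbad⟩ := hcmp (v + η / 2)
    have hlim := (hD (η / 2) (half_pos hη)).add hbad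
    rw [add_zero] at hlim
    refine squeeze_zero' (Eventually.of_forall fun n => measureReal_nonneg) ?_ hlim
    filter_upwards [hz.eventually_lt_const (show v + η / 2 < v + η by linarith)] with n hn
    refine (measureReal_mono ?_).trans (measureReal_union_le _ _)
    rintro ω ⟨h1, h2⟩
    by_cases hb : T n ω ≤ z n ↔ W n ω ≤ D n ω
    · left
      have h3 : ¬ W n ω ≤ D n ω := fun h => absurd (hb.2 h) (not_le.2 (by linarith))
      rw [not_le] at h3
      refine le_trans ?_ (neg_le_abs (D n ω - (v + η / 2)))
      linarith
    · exact Or.inr hb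
  set η := ε / 3 with hη
  have hη0 : 0 < η := by positivity
  rw [Metric.tendsto_nhds]
  intro δ hδ
  obtain ⟨M, hM⟩ := htight (δ / 2) (half_pos hδ)
  -- The range -N..N contains ⌊W/η⌋ whenever |W| < M; the extra 1 absorbs the rounding of the floor.
  set N : ℤ := ⌈|M| / η⌉ + 1 with hN
  have hsum : Tendsto (fun n => ∑ k ∈ Finset.Icc (-N) N,
      (P.real {ω | T n ω ≤ (k - 1) * η ∧ (k - 1) * η + η ≤ W n ω} +
        P.real {ω | (k + 1) * η + η ≤ T n ω ∧ W n ω ≤ (k + 1) * η})) atTop (𝓝 0) := by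
    have := tendsto_finsetSum (Finset.Icc (-N) N) fun k _ =>
      (hlow ((k - 1) * η) η hη0).add (hupp ((k + 1) * η) η hη0)
    simpa using this
  filter_upwards [hM, hsum.eventually_lt_const (half_pos hδ)] with n h1 h2
  rw [Real.dist_eq, sub_zero, abs_of_nonneg measureReal_nonneg]
  have hsub : {ω | ε ≤ |T n ω - W n ω|} ⊆ {ω | M ≤ |W n ω|} ∪
      ⋃ k ∈ Finset.Icc (-N) N, ({ω | T n ω ≤ (k - 1) * η ∧ (k - 1) * η + η ≤ W n ω} ∪
        {ω | (k + 1) * η + η ≤ T n ω ∧ W n ω ≤ (k + 1) * η}) := by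
    intro ω hω
    by_cases hw : M ≤ |W n ω|
    · exact Or.inl hw
    · right
      rw [not_le] at hw
      set k : ℤ := ⌊W n ω / η⌋ with hk
      have hk1 : (k : ℝ) * η ≤ W n ω := by
        rw [← le_div_iff₀ hη0]; exact Int.floor_le _
      have hk2 : W n ω ≤ (k + 1) * η := by
        rw [← div_le_iff₀ hη0]; exact (Int.lt_floor_add_one _).le
      have hwM : |W n ω / η| < |M| / η := by
        rw [abs_div, abs_of_pos hη0]
        exact div_lt_div_of_pos_right (hw.trans_le (le_abs_self M)) hη0
      have hceil := Int.le_ceil (|M| / η)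
      have hkmem : k ∈ Finset.Icc (-N) N := by
        rw [Finset.mem_Icc]
        have hlo := (abs_lt.1 hwM).1
        have hhi := (abs_lt.1 hwM).2
        constructor
        · rw [hk, Int.le_floor, hN]; push_cast; linarith
        · have h5 : (k : ℝ) ≤ W n ω / η := Int.floor_le _
          have : (k : ℝ) ≤ N := by rw [hN]; push_cast; linarith
          exact_mod_cast this
      simp only [mem_iUnion]
      refine ⟨k, hkmem, ?_⟩
      have hε3 : ε = 3 * η := by rw [hη]; ring
      rw [mem_ofPred_eq, hε3] at hω
      rcases le_abs.1 hω with h | h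
      · exact Or.inr ⟨by linarith, hk2⟩
      · exact Or.inl ⟨by linarith, by linarith⟩
  calc _ ≤ _ := measureReal_mono hsub
    _ ≤ _ := measureReal_union_le _ _
    _ ≤ δ / 2 + ∑ k ∈ Finset.Icc (-N) N,
      (P.real {ω | T n ω ≤ (k - 1) * η ∧ (k - 1) * η + η ≤ W n ω} +
        P.real {ω | (k + 1) * η + η ≤ T n ω ∧ W n ω ≤ (k + 1) * η}) := by
      refine add_le_add h1 ((measureReal_biUnion_finset_le _ _).trans ?_)
      exact Finset.sum_le_sum fun k _ => measureReal_union_le _ _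
    _ < δ := by linarith

/-! ### Smoothed moments -/

section Smoothing

variable {p : ℕ}

lemma integral_rescale (H : Cov p → ℝ) (x : Cov p) {h : ℝ} (hh : 0 < h) :
    ∫ u, H (h⁻¹ • (x - u)) = h ^ p * ∫ u, H u := by
  rw [integral_sub_left_eq_self (fun u => H (h⁻¹ • u)) volume x, Measure.integral_comp_inv_smul]
  simp [abs_of_pos (pow_pos hh p)]

lemma integrable_rescale {H : Cov p → ℝ} (hH : Integrable H) (x : Cov p) {h : ℝ} (hh : 0 < h) :
    Integrable fun u => H (h⁻¹ • (x - u)) :=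
  (hH.comp_smul (inv_ne_zero hh.ne')).comp_sub_left x

/-- The kernel lives on the closed ball while `F` is controlled on the open one, as in the
oscillation; the sphere between them is null. -/
lemma abs_integral_rescale_mul_sub_le {H : Cov p → ℝ} (hH : Integrable H)
    (hH0 : ∀ u, 0 ≤ H u) (hsupp : Function.support H ⊆ Metric.closedBall 0 1) (x : Cov p) {h : ℝ}
    (hh : 0 < h) {F : Cov p → ℝ} (hF : Measurable F) {c δ : ℝ}
    (hFc : ∀ u ∈ Metric.ball x h, |F u - c| ≤ δ) :
    |(∫ u, H (h⁻¹ • (x - u)) * F u) - h ^ p * (c * ∫ u, H u)| ≤ h ^ p * (δ * ∫ u, H u) := by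
  have hint := integrable_rescale hH x hh
  have hae : ∀ᵐ u, ‖H (h⁻¹ • (x - u)) * (F u - c)‖ ≤ δ * H (h⁻¹ • (x - u)) := by
    have hs : ∀ᵐ u, u ∉ Metric.sphere x h :=
      measure_eq_zero_iff_ae_notMem.1 (Measure.addHaar_sphere_of_ne_zero _ x hh.ne')
    filter_upwards [hs] with u hu
    rw [norm_mul, Real.norm_eq_abs, Real.norm_eq_abs, abs_of_nonneg (hH0 _), mul_comm]
    by_cases hz : H (h⁻¹ • (x - u)) = 0
    · simp [hz]
    · refine mul_le_mul_of_nonneg_right (hFc u ?_) (hH0 _)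
      have h1 := hsupp (Function.mem_support.2 hz)
      rw [mem_closedBall_zero_iff, norm_smul, norm_inv, Real.norm_eq_abs, abs_of_pos hh,
        inv_mul_le_iff₀ hh, mul_one] at h1
      rw [Metric.mem_ball, dist_comm, dist_eq_norm]
      refine lt_of_le_of_ne h1 fun he => hu ?_
      rw [Metric.mem_sphere, dist_comm, dist_eq_norm, he]
  have hint2 : Integrable fun u => H (h⁻¹ • (x - u)) * (F u - c) :=
    (hint.const_mul δ).mono' (hint.aestronglyMeasurable.mul
      (hF.sub_const c).aestronglyMeasurable) hae
  have heq : (∫ u, H (h⁻¹ • (x - u)) * F u) - h ^ p * (c * ∫ u, H u) =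
      ∫ u, H (h⁻¹ • (x - u)) * (F u - c) := by
    have hsplit : ∀ u, H (h⁻¹ • (x - u)) * F u =
        H (h⁻¹ • (x - u)) * (F u - c) + H (h⁻¹ • (x - u)) * c := fun u => by ring
    simp_rw [hsplit]
    rw [integral_add hint2 (hint.mul_const c), integral_mul_const, integral_rescale H x hh]
    ring
  rw [heq, ← Real.norm_eq_abs]
  refine (norm_integral_le_of_norm_le (hint.const_mul δ) hae).trans (le_of_eq ?_)
  rw [integral_const_mul, integral_rescale H x hh]
  ring

/-- The law of a pair whose first component has density `g` and whose second one has conditional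
law `Q`. -/
noncomputable def pairLaw (g : Cov p → ℝ) (Q : Kernel (Cov p) ℝ) : Measure (Cov p × ℝ) :=
  (volume.withDensity fun u => ENNReal.ofReal (g u)) ⊗ₘ Q

variable {g : Cov p → ℝ} {Q : Kernel (Cov p) ℝ} [IsMarkovKernel Q]

lemma integral_pairLaw (hg : Measurable g) (hg0 : ∀ u, 0 ≤ g u)
    [IsProbabilityMeasure (volume.withDensity fun u => ENNReal.ofReal (g u))]
    {A : Cov p → ℝ} (hA : Measurable A) {BA : ℝ} (hBA : ∀ u, |A u| ≤ BA)
    {ψ : ℝ → ℝ} (hψ : Measurable ψ) {Bψ : ℝ} (hBψ : ∀ y, |ψ y| ≤ Bψ) :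
    ∫ e, A e.1 * ψ e.2 ∂(pairLaw g Q) = ∫ u, A u * (g u * ∫ y, ψ y ∂(Q u)) := by
  have hint : Integrable (fun e : Cov p × ℝ => A e.1 * ψ e.2) (pairLaw g Q) := by
    unfold pairLaw
    refine Integrable.of_bound (by fun_prop) (BA * Bψ) (ae_of_all _ fun e => ?_)
    rw [norm_mul]
    exact mul_le_mul (hBA _) (hBψ _) (norm_nonneg _) ((abs_nonneg _).trans (hBA e.1))
  unfold pairLaw at hint ⊢
  rw [Measure.integral_compProd hint, integral_withDensity_eq_integral_toReal_smul
    (by fun_prop) (ae_of_all _ fun u => ENNReal.ofReal_lt_top)]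
  refine integral_congr_ae (ae_of_all _ fun u => ?_)
  simp only [smul_eq_mul, ENNReal.toReal_ofReal (hg0 u), integral_const_mul]
  ring

/-- Errors are measured relative to the size `a n` of the conditional mean: the Lipschitz error of
`g` multiplies that mean, so it only contributes a factor O(h). The sizes used below are α/σ, α and
1. -/
lemma tendsto_smoothed_moment (hg : Measurable g) (hg0 : ∀ u, 0 ≤ g u)
    [IsProbabilityMeasure (volume.withDensity fun u => ENNReal.ofReal (g u))]
    {L : ℝ} (hL : ∀ u v, |g u - g v| ≤ L * dist u v)
    {H : Cov p → ℝ} (hHm : Measurable H) {BH : ℝ} (hBH : ∀ u, H u ≤ BH) (hH : Integrable H)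
    (hH0 : ∀ u, 0 ≤ H u) (hsupp : Function.support H ⊆ Metric.closedBall 0 1) (x : Cov p)
    {h : ℕ → ℝ} (hh : ∀ n, 0 < h n) (hh0 : Tendsto h atTop (𝓝 0))
    {ψ : ℕ → ℝ → ℝ} (hψ : ∀ n, Measurable (ψ n)) {B : ℕ → ℝ} (hB : ∀ n y, |ψ n y| ≤ B n)
    {a δ : ℕ → ℝ} {l : ℝ} (ha : ∀ᶠ n in atTop, 0 < a n) (hδ : Tendsto δ atTop (𝓝 0))
    (hψl : ∀ᶠ n in atTop, ∀ u ∈ Metric.ball x (h n),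
      |∫ y, ψ n y ∂(Q u) - a n * l| ≤ a n * δ n) :
    Tendsto (fun n => (∫ e, H ((h n)⁻¹ • (x - e.1)) * ψ n e.2 ∂(pairLaw g Q)) / (h n ^ p * a n))
      atTop (𝓝 (g x * l * ∫ u, H u)) := by
  have hlim : Tendsto (fun n => ((g x + |L| * h n) * δ n + |L| * h n * |l|) * ∫ u, H u)
      atTop (𝓝 0) := by
    have h1 := hh0.const_mul |L|
    have := (((h1.const_add (g x)).mul hδ).add (h1.mul_const |l|)).mul_const (∫ u, H u)
    simpa using this
  rw [tendsto_iff_dist_tendsto_zero]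
  refine squeeze_zero' (Eventually.of_forall fun n => dist_nonneg) ?_ hlim
  filter_upwards [ha, hψl] with n han hn
  have hmeas : Measurable fun u => g u * ∫ y, ψ n y ∂(Q u) :=
    hg.mul (hψ n).stronglyMeasurable.integral_kernel.measurable
  have hab : ∀ u, |H ((h n)⁻¹ • (x - u))| ≤ BH := fun u => by
    rw [abs_of_nonneg (hH0 _)]; exact hBH _
  rw [integral_pairLaw hg hg0 (A := fun u => H ((h n)⁻¹ • (x - u))) (by fun_prop) hab (hψ n) (hB n)]
  have hδ0 : 0 ≤ a n * δ n := (abs_nonneg _).trans (hn x (Metric.mem_ball_self (hh n)))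
  have hbound : ∀ u ∈ Metric.ball x (h n), |g u * ∫ y, ψ n y ∂(Q u) - a n * (g x * l)| ≤
      a n * ((g x + |L| * h n) * δ n + |L| * h n * |l|) := by
    intro u hu
    have h1 : |g u - g x| ≤ |L| * h n := (hL u x).trans
      (mul_le_mul (le_abs_self L) (Metric.mem_ball.1 hu).le dist_nonneg (abs_nonneg L))
    have h2 := hn u hu
    have h3 : g u ≤ g x + |L| * h n := by linarith [le_abs_self (g u - g x)]
    calc _ = |g u * (∫ y, ψ n y ∂(Q u) - a n * l) + (g u - g x) * (a n * l)| := by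
          congr 1; ring
      _ ≤ |g u * (∫ y, ψ n y ∂(Q u) - a n * l)| + |(g u - g x) * (a n * l)| := abs_add_le _ _
      _ ≤ (g x + |L| * h n) * (a n * δ n) + |L| * h n * (a n * |l|) := by
          rw [abs_mul, abs_mul, abs_of_nonneg (hg0 u), abs_mul (a n), abs_of_pos han]
          refine add_le_add (mul_le_mul h3 h2 (abs_nonneg _) ((hg0 u).trans h3)) ?_
          gcongr
      _ = _ := by ring
  have key := abs_integral_rescale_mul_sub_le hH hH0 hsupp x (hh n) hmeas hbound
  have hpos : 0 < h n ^ p * a n := mul_pos (pow_pos (hh n) p) han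
  rw [Real.dist_eq, div_sub' hpos.ne', abs_div, abs_of_pos hpos, div_le_iff₀ hpos]
  refine le_trans (le_of_eq ?_) (key.trans (le_of_eq ?_))
  · congr 1; ring
  · ring

end Smoothing

/-! ### Measurability of generalized inverses -/

/-- The real infimum is 0 both for an empty set and for one unbounded below, so these events are
treated apart. Monotonicity reduces everything to integer and rational arguments. -/
lemma measurable_genInv {Ω : Type*} [MeasurableSpace Ω] {F : Ω → ℝ → ℝ}
    (hF : ∀ ω, Antitone (F ω)) (hm : ∀ t, Measurable fun ω => F ω t) (c : ℝ) :
    Measurable fun ω => genInv (F ω) c := by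
  refine measurable_of_Iio fun s => ?_
  have hup : ∀ ω t t', t ≤ t' → F ω t ≤ c → F ω t' ≤ c := fun ω t t' htt h => (hF ω htt).trans h
  have hle : ∀ t, MeasurableSet {ω | F ω t ≤ c} := fun t => measurableSet_le (hm t) measurable_const
  have hset : (fun ω => genInv (F ω) c) ⁻¹' Iio s =
      ({ω | 0 < s} ∩ ((⋂ k : ℕ, {ω | F ω k ≤ c}ᶜ) ∪ ⋂ k : ℕ, {ω | F ω (-(k : ℝ)) ≤ c})) ∪
      (((⋃ k : ℕ, {ω | F ω k ≤ c}) ∩ ⋃ k : ℕ, {ω | F ω (-(k : ℝ)) ≤ c}ᶜ) ∩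
        ⋃ q : ℚ, {ω | (q : ℝ) < s} ∩ {ω | F ω q ≤ c}) := by
    ext ω
    simp only [mem_preimage, mem_Iio, mem_union, mem_inter_iff, mem_iInter, mem_iUnion,
      mem_compl_iff, mem_ofPred_eq]
    by_cases hne : ∃ k : ℕ, F ω k ≤ c
    · by_cases hbd : ∃ k : ℕ, ¬ F ω (-(k : ℝ)) ≤ c
      · have h1 : ¬ ∀ k : ℕ, ¬ F ω k ≤ c := by push Not; exact (by simpa using hne)
        have h2 : ¬ ∀ k : ℕ, F ω (-(k : ℝ)) ≤ c := by push Not; exact (by simpa using hbd)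
        simp only [h1, h2, hne, hbd, or_self, and_false, false_or, true_and]
        obtain ⟨k, hk⟩ := hne
        obtain ⟨k', hk'⟩ := hbd
        have hbdd : BddBelow {t : ℝ | F ω t ≤ c} := ⟨-(k' : ℝ), fun t ht => by
          by_contra! hlt
          exact hk' (hup ω _ _ hlt.le ht)⟩
        rw [genInv, csInf_lt_iff hbdd ⟨_, hk⟩]
        constructor
        · rintro ⟨t, ht, hts⟩
          obtain ⟨q, hq1, hq2⟩ := exists_rat_btwn hts
          exact ⟨q, hq2, hup ω _ _ hq1.le ht⟩
        · rintro ⟨q, hq1, hq2⟩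
          exact ⟨q, hq2, hq1⟩
      · have h0 : genInv (F ω) c = 0 := by
          rw [genInv]
          refine Real.sInf_of_not_bddBelow ?_
          rintro ⟨b, hb⟩
          obtain ⟨k, hk⟩ := exists_nat_gt (-b)
          push Not at hbd
          have := hb (hbd k)
          linarith
        have h2 : ∀ k : ℕ, F ω (-(k : ℝ)) ≤ c := by push Not at hbd; exact hbd
        simp [h0, h2]
    · have h0 : genInv (F ω) c = 0 := by
        rw [genInv]
        have : {t : ℝ | F ω t ≤ c} = ∅ := by
          refine eq_empty_of_forall_notMem fun t ht => hne ?_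
          obtain ⟨k, hk⟩ := exists_nat_ge t
          exact ⟨k, hup ω _ _ hk ht⟩
        rw [this, Real.sInf_empty]
      push Not at hne
      have h1 : ∀ k : ℕ, ¬ F ω k ≤ c := fun k => not_le.2 (hne k)
      simp [h0, h1]
  rw [hset]
  refine MeasurableSet.union (MeasurableSet.inter (MeasurableSet.const _)
    (MeasurableSet.union (MeasurableSet.iInter fun k => (hle _).compl)
      (MeasurableSet.iInter fun k => hle _))) (MeasurableSet.inter (MeasurableSet.inter
      (MeasurableSet.iUnion fun k => hle _) (MeasurableSet.iUnion fun k => (hle _).compl))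
      (MeasurableSet.iUnion fun q => (MeasurableSet.const _).inter (hle _)))

/-! ### The kernel estimators -/

/-- The centered exceedance indicator `1{y > t} - c`. -/
noncomputable def excess (t c y : ℝ) : ℝ := (Ioi t).indicator 1 y - c

@[fun_prop]
lemma measurable_excess (t c : ℝ) : Measurable (excess t c) :=
  (measurable_one.indicator measurableSet_Ioi).sub_const c

lemma indicator_Ioi_mem (t y : ℝ) : (Ioi t).indicator (1 : ℝ → ℝ) y ∈ Icc (0 : ℝ) 1 := by
  by_cases h : y ∈ Ioi t
  · simp [indicator_of_mem h]
  · simp [indicator_of_notMem h]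

lemma abs_excess_le (t c y : ℝ) : |excess t c y| ≤ 1 + |c| := by
  have := indicator_Ioi_mem t y
  refine (abs_sub _ _).trans ?_
  rw [abs_of_nonneg this.1]
  linarith [this.2]

section Estimators

variable {p : ℕ} {K : Cov p → ℝ} {h : ℝ} {n : ℕ} {X : ℕ → Cov p} {Y : ℕ → ℝ} {x : Cov p}

lemma rescaled_nonneg (hK : ∀ u, 0 ≤ K u) (hh : 0 < h) (u : Cov p) : 0 ≤ rescaled K h u :=
  div_nonneg (hK _) (pow_pos hh p).le

lemma antitone_csfEst (hK : ∀ u, 0 ≤ K u) (hh : 0 < h) : Antitone (csfEst K h n X Y x) := by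
  intro s t hst
  refine div_le_div_of_nonneg_right ?_ (Finset.sum_nonneg fun i _ => rescaled_nonneg hK hh _)
  refine Finset.sum_le_sum fun i _ => mul_le_mul_of_nonneg_left ?_ (rescaled_nonneg hK hh _)
  exact indicator_le_indicator_of_subset (Ioi_subset_Ioi hst) (fun _ => zero_le_one) _

lemma continuousWithinAt_indicator_Ioi (y t : ℝ) :
    ContinuousWithinAt (fun s => (Ioi s).indicator (1 : ℝ → ℝ) y) (Ici t) t := by
  rcases lt_or_ge t y with hlt | hle
  · refine (continuousWithinAt_const (b := (1 : ℝ))).congr_of_eventuallyEq ?_ ?_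
    · filter_upwards [nhdsWithin_le_nhds (Iio_mem_nhds hlt)] with s hs
      exact indicator_of_mem (mem_Ioi.2 hs) _
    · exact indicator_of_mem (mem_Ioi.2 hlt) _
  · refine (continuousWithinAt_const (b := (0 : ℝ))).congr (fun s hs => ?_) ?_
    · exact indicator_of_notMem (not_lt.2 (hle.trans hs)) _
    · exact indicator_of_notMem (not_lt.2 hle) _

lemma csfEst_le_iff (hh : 0 < h) (hS : 0 < ∑ i ∈ Finset.range n, K (h⁻¹ • (x - X i))) {t c : ℝ} :
    csfEst K h n X Y x t ≤ c ↔
      ∑ i ∈ Finset.range n, K (h⁻¹ • (x - X i)) * excess t c (Y i) ≤ 0 := by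
  have hp : (0 : ℝ) < h ^ p := pow_pos hh p
  have h1 : ∑ i ∈ Finset.range n, rescaled K h (x - X i) =
      (∑ i ∈ Finset.range n, K (h⁻¹ • (x - X i))) / h ^ p := by
    rw [Finset.sum_div]; rfl
  have h2 : ∑ i ∈ Finset.range n, rescaled K h (x - X i) * (Ioi t).indicator 1 (Y i) =
      (∑ i ∈ Finset.range n, K (h⁻¹ • (x - X i)) * (Ioi t).indicator 1 (Y i)) / h ^ p := by
    rw [Finset.sum_div]
    exact Finset.sum_congr rfl fun i _ => by rw [rescaled]; ring
  rw [csfEst, h1, h2, div_div_div_cancel_right₀ hp.ne', div_le_iff₀ hS, ← sub_nonpos,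
    Finset.mul_sum, ← Finset.sum_sub_distrib]
  refine Iff.of_eq (congrArg (· ≤ (0 : ℝ)) (Finset.sum_congr rfl fun i _ => ?_))
  rw [excess]; ring

/-- This inversion makes the event depend on the data only through the sign of a sum of functions of
single observations. -/
lemma quantileEst_le_iff (hK : ∀ u, 0 ≤ K u) (hh : 0 < h)
    (hS : 0 < ∑ i ∈ Finset.range n, K (h⁻¹ • (x - X i))) {c : ℝ} (hc : 0 ≤ c) (hc1 : c < 1)
    {t : ℝ} : quantileEst K h n X Y x c ≤ t ↔
      ∑ i ∈ Finset.range n, K (h⁻¹ • (x - X i)) * excess t c (Y i) ≤ 0 := by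
  rw [← csfEst_le_iff hh hS]
  have hY : ∀ i ∈ Finset.range n, |Y i| ≤ ∑ i ∈ Finset.range n, |Y i| := fun i hi =>
    Finset.single_le_sum (f := fun i => |Y i|) (fun i _ => abs_nonneg _) hi
  -- At Σ|Y_i| the estimator is 0 ≤ c; at -Σ|Y_i| - 1 it is 1 > c.
  refine genInv_le_iff (antitone_csfEst hK hh) (fun t => ?_)
    ⟨∑ i ∈ Finset.range n, |Y i|, ?_⟩ ⟨-(∑ i ∈ Finset.range n, |Y i|) - 1, ?_⟩
  · unfold csfEst
    exact ContinuousWithinAt.div_const (tendsto_finsetSum _ fun i _ =>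
      (continuousWithinAt_indicator_Ioi (Y i) t).const_mul _) _
  · rw [csfEst_le_iff hh hS]
    refine Finset.sum_nonpos fun i hi => mul_nonpos_of_nonneg_of_nonpos (hK _) ?_
    rw [excess, indicator_of_notMem
      (show Y i ∉ Ioi _ from not_lt.2 ((le_abs_self _).trans (hY i hi)))]
    linarith
  · rw [← not_le, csfEst_le_iff hh hS, not_le]
    have : ∀ i ∈ Finset.range n, K (h⁻¹ • (x - X i)) *
        excess (-(∑ i ∈ Finset.range n, |Y i|) - 1) c (Y i) =
        K (h⁻¹ • (x - X i)) * (1 - c) := fun i hi => by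
      rw [excess, indicator_of_mem (mem_Ioi.2 (by linarith [hY i hi, neg_abs_le (Y i)]))]
      rfl
    rw [Finset.sum_congr rfl this, ← Finset.sum_mul]
    exact mul_pos hS (by linarith)

lemma measurable_quantileEst {Ω : Type*} [MeasurableSpace Ω] (hKm : Measurable K)
    (hK : ∀ u, 0 ≤ K u) (hh : 0 < h) {X : ℕ → Ω → Cov p} {Y : ℕ → Ω → ℝ}
    (hX : ∀ i, Measurable (X i)) (hY : ∀ i, Measurable (Y i)) (c : ℝ) :
    Measurable fun ω => quantileEst K h n (fun i => X i ω) (fun i => Y i ω) x c := by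
  refine measurable_genInv (fun ω => antitone_csfEst hK hh) (fun t => ?_) c
  have h1 : ∀ i, Measurable fun ω => rescaled K h (x - X i ω) := fun i => by
    unfold rescaled
    exact (hKm.comp (((hX i).const_sub x).const_smul h⁻¹)).div_const _
  have h2 : ∀ i, Measurable fun ω => (Ioi t).indicator (1 : ℝ → ℝ) (Y i ω) := fun i =>
    (measurable_one.indicator measurableSet_Ioi).comp (hY i)
  unfold csfEst
  exact (Finset.measurable_fun_sum _ fun i _ => (h1 i).mul (h2 i)).div
    (Finset.measurable_fun_sum _ fun i _ => h1 i)

end Estimators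

/-! ### Conditional survival functions -/

section Conditional

variable {p : ℕ} {Q : Kernel (Cov p) ℝ} [IsMarkovKernel Q]

lemma isContSurvival_csf {x : Cov p} (hc : Continuous (csf Q x)) : IsContSurvival (csf Q x) where
  antitone s t hst := measureReal_mono (Ioi_subset_Ioi hst)
  continuous := hc
  limit_atTop := by
    have h := tendsto_measure_iInter_atTop (μ := Q x) (s := fun t : ℝ => Ioi t)
      (fun t => measurableSet_Ioi.nullMeasurableSet) (fun s t hst => Ioi_subset_Ioi hst)
      ⟨0, measure_ne_top _ _⟩
    have he : ⋂ t : ℝ, Ioi t = ∅ :=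
      eq_empty_of_forall_notMem fun y hy => lt_irrefl y (mem_iInter.1 hy y)
    rw [he, measure_empty] at h
    exact (ENNReal.tendsto_toReal ENNReal.zero_ne_top).comp h
  limit_atBot := by
    have h := tendsto_measure_iUnion_atBot (μ := Q x) (s := fun t : ℝ => Ioi t)
      (fun s t hst => Ioi_subset_Ioi hst)
    have he : ⋃ t : ℝ, Ioi t = univ :=
      eq_univ_of_forall fun y => mem_iUnion.2 ⟨y - 1, sub_one_lt y⟩
    rw [he, measure_univ] at h
    exact (ENNReal.tendsto_toReal ENNReal.one_ne_top).comp h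

lemma integrable_indicator_Ioi (u : Cov p) (t : ℝ) :
    Integrable ((Ioi t).indicator (1 : ℝ → ℝ)) (Q u) :=
  (integrable_const (1 : ℝ)).indicator measurableSet_Ioi

omit [IsMarkovKernel Q] in
lemma integral_indicator_Ioi (u : Cov p) (t : ℝ) :
    ∫ y, (Ioi t).indicator (1 : ℝ → ℝ) y ∂(Q u) = csf Q u t :=
  integral_indicator_one measurableSet_Ioi

lemma integral_excess (u : Cov p) (t c : ℝ) : ∫ y, excess t c y ∂(Q u) = csf Q u t - c := by
  unfold excess
  rw [integral_sub (integrable_indicator_Ioi u t) (integrable_const c), integral_indicator_Ioi]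
  simp

lemma csf_mem (u : Cov p) (t : ℝ) : csf Q u t ∈ Icc (0 : ℝ) 1 :=
  ⟨measureReal_nonneg, measureReal_le_one⟩

/-- The centres cancel, and the squared difference of two nested indicators is the indicator of the
interval between the thresholds. -/
lemma integral_excess_sub_sq_le (u : Cov p) (s t c : ℝ) :
    ∫ y, (excess s c y - excess t c y) ^ 2 ∂(Q u) ≤ |csf Q u s - csf Q u t| := by
  have hI := fun t => integrable_indicator_Ioi (Q := Q) u t
  have key : ∀ s t, s ≤ t →
      ∫ y, (excess s c y - excess t c y) ^ 2 ∂(Q u) = csf Q u s - csf Q u t := by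
    intro s t hst
    rw [← integral_indicator_Ioi u s, ← integral_indicator_Ioi u t, ← integral_sub (hI s) (hI t)]
    refine integral_congr_ae (ae_of_all _ fun y => ?_)
    simp only [excess, sub_sub_sub_cancel_right]
    by_cases h1 : y ∈ Ioi t
    · rw [indicator_of_mem h1, indicator_of_mem (Ioi_subset_Ioi hst h1)]; simp
    · rw [indicator_of_notMem h1]
      by_cases h2 : y ∈ Ioi s
      · rw [indicator_of_mem h2]; simp
      · rw [indicator_of_notMem h2]; simp
  rcases le_total s t with hst | hst
  · rw [key s t hst]; exact le_abs_self _
  · have : ∀ y, (excess s c y - excess t c y) ^ 2 = (excess t c y - excess s c y) ^ 2 :=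
      fun y => by ring
    simp_rw [this]
    rw [key t s hst, abs_sub_comm]
    exact le_abs_self _

lemma integral_excess_mul_excess (u : Cov p) {s t : ℝ} (hst : s ≤ t) (c d : ℝ) :
    ∫ y, excess s c y * excess t d y ∂(Q u) =
      csf Q u t - d * csf Q u s - c * csf Q u t + c * d := by
  have hI := fun t => integrable_indicator_Ioi (Q := Q) u t
  have heq : ∀ y, excess s c y * excess t d y = (Ioi t).indicator (1 : ℝ → ℝ) y -
      d * (Ioi s).indicator (1 : ℝ → ℝ) y - c * (Ioi t).indicator (1 : ℝ → ℝ) y + c * d := by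
    intro y
    have hprod : (Ioi s).indicator (1 : ℝ → ℝ) y * (Ioi t).indicator (1 : ℝ → ℝ) y =
        (Ioi t).indicator (1 : ℝ → ℝ) y := by
      by_cases h1 : y ∈ Ioi t
      · rw [indicator_of_mem h1, indicator_of_mem (Ioi_subset_Ioi hst h1)]; simp
      · rw [indicator_of_notMem h1]; simp
    simp only [excess]
    linear_combination hprod
  simp_rw [heq]
  have h1 : Integrable (fun y => (Ioi t).indicator (1 : ℝ → ℝ) y -
      d * (Ioi s).indicator (1 : ℝ → ℝ) y) (Q u) := (hI t).sub ((hI s).const_mul d)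
  have h2 : Integrable (fun y => (Ioi t).indicator (1 : ℝ → ℝ) y -
      d * (Ioi s).indicator (1 : ℝ → ℝ) y - c * (Ioi t).indicator (1 : ℝ → ℝ) y) (Q u) :=
    h1.sub ((hI t).const_mul c)
  rw [integral_add h2 (integrable_const _), integral_sub h1 ((hI t).const_mul c),
    integral_sub (hI t) ((hI s).const_mul d), integral_const_mul, integral_const_mul,
    integral_indicator_Ioi, integral_indicator_Ioi]
  simp

/-- Without boundedness the real supremum would be the default value 0 and would control nothing;
probabilities are at most 1 and β ≥ κα. -/
lemma bddAbove_oscillation (x : Cov p) (h : ℝ) {κ r α : ℝ} (hκ : 0 < κ) (hα : 0 < α) :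
    BddAbove ((fun z : Cov p × ℝ => |csf Q z.1 (quantile Q x z.2) / z.2 - 1|) ''
      (Metric.ball x h ×ˢ Icc (κ * α) (r * α))) := by
  refine ⟨1 / (κ * α) + 1, ?_⟩
  rintro _ ⟨⟨u, β⟩, ⟨-, hβ⟩, rfl⟩
  have hκα : 0 < κ * α := mul_pos hκ hα
  have hβ0 : 0 < β := hκα.trans_le hβ.1
  have h1 := csf_mem (Q := Q) u (quantile Q x β)
  refine (abs_sub _ _).trans ?_
  rw [abs_one, abs_div, abs_of_nonneg h1.1, abs_of_pos hβ0]
  gcongr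
  · exact h1.2
  · exact hβ.1

lemma abs_csf_sub_le_oscillation {x u : Cov p} {h : ℝ} (hu : u ∈ Metric.ball x h) {κ r α β : ℝ}
    (hκ : 0 < κ) (hα : 0 < α) (hβ : β ∈ Icc (κ * α) (r * α)) :
    |csf Q u (quantile Q x β) - β| ≤ r * α * oscillation Q x h κ r α := by
  have hβ0 : 0 < β := (mul_pos hκ hα).trans_le hβ.1
  have h1 : |csf Q u (quantile Q x β) / β - 1| ≤ oscillation Q x h κ r α :=
    le_csSup (bddAbove_oscillation x h hκ hα) ⟨(u, β), ⟨hu, hβ⟩, rfl⟩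
  have h2 : csf Q u (quantile Q x β) - β = β * (csf Q u (quantile Q x β) / β - 1) := by
    field_simp
  rw [h2, abs_mul, abs_of_pos hβ0]
  exact mul_le_mul hβ.2 h1 (abs_nonneg _) (hβ0.le.trans hβ.2)

omit [IsMarkovKernel Q] in
lemma oscillation_nonneg (x : Cov p) (h κ r α : ℝ) : 0 ≤ oscillation Q x h κ r α := by
  refine Real.sSup_nonneg ?_
  rintro _ ⟨z, -, rfl⟩
  exact abs_nonneg _

end Conditional

/-! ### The smoothing regime -/

/-- The assumptions on the design density, the kernel, the bandwidth and the level under which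
conditional tail probabilities near the point `x` are estimated without asymptotic bias. -/
structure SmoothingRegime {p : ℕ} (g : Cov p → ℝ) (Q : Kernel (Cov p) ℝ) (K : Cov p → ℝ)
    (x : Cov p) (h α : ℕ → ℝ) (κ r : ℝ) : Prop where
  measurable : Measurable g
  nonneg : ∀ u, 0 ≤ g u
  isProb : IsProbabilityMeasure (volume.withDensity fun u => ENNReal.ofReal (g u))
  lipschitz : ∃ L : ℝ, ∀ u v, |g u - g v| ≤ L * dist u v
  kernel : IsBoundedDensity K
  bandwidth_pos : ∀ n, 0 < h n
  bandwidth_lim : Tendsto h atTop (𝓝 0)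
  level_lim : Tendsto α atTop (𝓝 0)
  rate : Tendsto (fun n : ℕ => (n : ℝ) * h n ^ p * α n) atTop atTop
  kappa_pos : 0 < κ
  bias : Tendsto (fun n : ℕ => (n : ℝ) * h n ^ p * α n *
    (max (h n) (oscillation Q x (h n) κ r (α n))) ^ 2) atTop (𝓝 0)
  survival : IsContSurvival (csf Q x)

/-- The square root of the effective number of observations. -/
noncomputable def effRate (p : ℕ) (h α : ℕ → ℝ) (n : ℕ) : ℝ := √((n : ℝ) * h n ^ p * α n)

/-- The conditional quantile of level `τ α_n exp (-v / σ_n)`, where `σ_n` is the rate. -/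
noncomputable def localQuantile {p : ℕ} (Q : Kernel (Cov p) ℝ) (x : Cov p) (h α : ℕ → ℝ)
    (τ v : ℝ) (n : ℕ) : ℝ := quantile Q x (τ * α n * Real.exp (-(v / effRate p h α n)))

/-- The exceedance indicator of a local quantile, centered at `τ α_n`. -/
noncomputable def localExcess {p : ℕ} (Q : Kernel (Cov p) ℝ) (x : Cov p) (h α : ℕ → ℝ)
    (τ v : ℝ) (n : ℕ) : ℝ → ℝ := excess (localQuantile Q x h α τ v n) (τ * α n)

lemma localQuantile_zero {p : ℕ} (Q : Kernel (Cov p) ℝ) (x : Cov p) (h α : ℕ → ℝ) (τ : ℝ)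
    (n : ℕ) : localQuantile Q x h α τ 0 n = quantile Q x (τ * α n) := by
  simp [localQuantile]

@[fun_prop]
lemma measurable_localExcess {p : ℕ} (Q : Kernel (Cov p) ℝ) (x : Cov p) (h α : ℕ → ℝ)
    (τ v : ℝ) (n : ℕ) : Measurable (localExcess Q x h α τ v n) := measurable_excess _ _

lemma abs_localExcess_le {p : ℕ} (Q : Kernel (Cov p) ℝ) (x : Cov p) (h α : ℕ → ℝ)
    (τ v : ℝ) (n : ℕ) (y : ℝ) : |localExcess Q x h α τ v n y| ≤ 1 + |τ * α n| :=
  abs_excess_le _ _ _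

namespace SmoothingRegime

variable {p : ℕ} {g : Cov p → ℝ} {Q : Kernel (Cov p) ℝ} [IsMarkovKernel Q] {K : Cov p → ℝ}
  {x : Cov p} {h α : ℕ → ℝ} {κ r : ℝ}

omit [IsMarkovKernel Q] in
-- The divergence of n h^p α forces the sign.
lemma level_pos (R : SmoothingRegime g Q K x h α κ r) : ∀ᶠ n in atTop, 0 < α n := by
  filter_upwards [R.rate.eventually_gt_atTop 0] with n hn
  by_contra! hle
  have : (n : ℝ) * h n ^ p * α n ≤ 0 :=
    mul_nonpos_of_nonneg_of_nonpos (mul_nonneg n.cast_nonneg (pow_pos (R.bandwidth_pos n) p).le) hle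
  linarith

omit [IsMarkovKernel Q] in
lemma tendsto_effRate (R : SmoothingRegime g Q K x h α κ r) :
    Tendsto (effRate p h α) atTop atTop := Real.tendsto_sqrt_atTop.comp R.rate

omit [IsMarkovKernel Q] in
lemma effRate_sq (R : SmoothingRegime g Q K x h α κ r) :
    ∀ᶠ n in atTop, effRate p h α n ^ 2 = n * h n ^ p * α n := by
  filter_upwards [R.rate.eventually_gt_atTop 0] with n hn
  exact Real.sq_sqrt hn.le

omit [IsMarkovKernel Q] in
lemma tendsto_effRate_mul_oscillation (R : SmoothingRegime g Q K x h α κ r) :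
    Tendsto (fun n => effRate p h α n * oscillation Q x (h n) κ r (α n)) atTop (𝓝 0) := by
  have h1 := (Real.continuous_sqrt.tendsto 0).comp R.bias
  rw [Real.sqrt_zero] at h1
  refine squeeze_zero' (Eventually.of_forall fun n =>
    mul_nonneg (Real.sqrt_nonneg _) (oscillation_nonneg _ _ _ _ _)) ?_ h1
  filter_upwards [R.rate.eventually_gt_atTop 0] with n hn
  have hmax : 0 ≤ max (h n) (oscillation Q x (h n) κ r (α n)) :=
    (R.bandwidth_pos n).le.trans (le_max_left _ _)
  simp only [Function.comp]
  rw [Real.sqrt_mul hn.le, Real.sqrt_sq hmax]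
  exact mul_le_mul_of_nonneg_left (le_max_right _ _) (Real.sqrt_nonneg _)

omit [IsMarkovKernel Q] in
lemma tendsto_oscillation (R : SmoothingRegime g Q K x h α κ r) :
    Tendsto (fun n => oscillation Q x (h n) κ r (α n)) atTop (𝓝 0) := by
  have h1 := R.tendsto_effRate_mul_oscillation.mul R.tendsto_effRate.inv_tendsto_atTop
  rw [zero_mul] at h1
  refine h1.congr' ?_
  filter_upwards [R.tendsto_effRate.eventually_gt_atTop 0] with n hn
  simp only [Pi.inv_apply]
  field_simp

omit [IsMarkovKernel Q] in
lemma tendsto_local_factor (R : SmoothingRegime g Q K x h α κ r) (v : ℝ) :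
    Tendsto (fun n => Real.exp (-(v / effRate p h α n))) atTop (𝓝 1) := by
  have h1 : Tendsto (fun n => v / effRate p h α n) atTop (𝓝 0) :=
    tendsto_const_nhds.div_atTop R.tendsto_effRate
  have := (Real.continuous_exp.tendsto _).comp h1.neg
  rwa [neg_zero, Real.exp_zero] at this

omit [IsMarkovKernel Q] in
-- This is the derivative of t ↦ exp(-vt) at 0, taken along t = 1/σ.
lemma tendsto_effRate_mul_local_factor (R : SmoothingRegime g Q K x h α κ r) (v : ℝ) :
    Tendsto (fun n => effRate p h α n * (Real.exp (-(v / effRate p h α n)) - 1)) atTop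
      (𝓝 (-v)) := by
  have hd : HasDerivAt (fun t => Real.exp (-(v * t))) (-v) 0 := by
    have := ((hasDerivAt_id (0 : ℝ)).const_mul v).neg.exp
    simpa using this
  have h1 := hd.tendsto_slope_zero_right.comp
    (tendsto_nhdsWithin_iff.2 ⟨R.tendsto_effRate.inv_tendsto_atTop,
      (R.tendsto_effRate.eventually_gt_atTop 0).mono fun n hn => inv_pos.2 hn⟩)
  refine h1.congr fun n => ?_
  simp [div_eq_mul_inv]

omit [IsMarkovKernel Q] in
-- The strict inequalities κ < τ < r leave room for the factor tending to 1, so the oscillation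
-- controls the shifted levels as well.
lemma local_level_mem (R : SmoothingRegime g Q K x h α κ r) {τ : ℝ} (hκ : κ < τ) (hr : τ < r)
    (v : ℝ) : ∀ᶠ n in atTop,
      τ * α n * Real.exp (-(v / effRate p h α n)) ∈ Icc (κ * α n) (r * α n) := by
  have h1 := (R.tendsto_local_factor v).const_mul τ
  rw [mul_one] at h1
  filter_upwards [R.level_pos, h1.eventually_const_lt hκ, h1.eventually_lt_const hr]
    with n h0 h2 h3
  rw [mul_right_comm]
  exact ⟨mul_le_mul_of_nonneg_right h2.le h0.le, mul_le_mul_of_nonneg_right h3.le h0.le⟩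

lemma abs_csf_localQuantile_sub_le (R : SmoothingRegime g Q K x h α κ r) {τ : ℝ} (hκ : κ < τ)
    (hr : τ < r) (v : ℝ) : ∀ᶠ n in atTop, ∀ u ∈ Metric.ball x (h n),
      |csf Q u (localQuantile Q x h α τ v n) - τ * α n * Real.exp (-(v / effRate p h α n))| ≤
        r * α n * oscillation Q x (h n) κ r (α n) := by
  filter_upwards [R.level_pos, R.local_level_mem hκ hr v] with n h0 h1 u hu
  exact abs_csf_sub_le_oscillation hu R.kappa_pos h0 h1

/-- The first moment of a locally centered exceedance. -/
lemma tendsto_moment_localExcess (R : SmoothingRegime g Q K x h α κ r) {τ : ℝ} (hκ : κ < τ)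
    (hr : τ < r) (v : ℝ) :
    Tendsto (fun n => (∫ e, K ((h n)⁻¹ • (x - e.1)) * localExcess Q x h α τ v n e.2
      ∂(pairLaw g Q)) / (h n ^ p * (α n / effRate p h α n))) atTop (𝓝 (-(g x * τ * v))) := by
  have := R.isProb
  obtain ⟨L, hL⟩ := R.lipschitz
  obtain ⟨B, hB⟩ := R.kernel.bounded
  have hKint : Integrable K := Integrable.of_integral_ne_zero (by simp [R.kernel.integral_eq_one])
  -- After centering, the conditional mean has size α/σ rather than α. The oscillation error
  -- therefore counts multiplied by σ; the second term is the linearization error of the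
  -- exponential.
  have hδ : Tendsto (fun n => r * (effRate p h α n * oscillation Q x (h n) κ r (α n)) +
      |τ * (effRate p h α n * (Real.exp (-(v / effRate p h α n)) - 1)) + τ * v|) atTop (𝓝 0) := by
    have h1 := (((R.tendsto_effRate_mul_local_factor v).const_mul τ).add_const (τ * v)).abs
    have h2 := (R.tendsto_effRate_mul_oscillation.const_mul r).add h1
    simpa using h2
  have key := tendsto_smoothed_moment (Q := Q) R.measurable R.nonneg hL R.kernel.measurable hB hKint
    R.kernel.nonneg R.kernel.support_subset x R.bandwidth_pos R.bandwidth_lim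
    (ψ := localExcess Q x h α τ v) (fun n => measurable_localExcess Q x h α τ v n)
    (abs_localExcess_le Q x h α τ v) (a := fun n => α n / effRate p h α n) (l := -(τ * v))
    (by filter_upwards [R.level_pos, R.tendsto_effRate.eventually_gt_atTop 0] with n h1 h2
        exact div_pos h1 h2) hδ (by
      filter_upwards [R.level_pos, R.tendsto_effRate.eventually_gt_atTop 0,
        R.abs_csf_localQuantile_sub_le hκ hr v] with n h1 h2 h3 u hu
      rw [localExcess, integral_excess]
      calc _ = |(csf Q u (localQuantile Q x h α τ v n) -
              τ * α n * Real.exp (-(v / effRate p h α n))) + α n / effRate p h α n *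
              (τ * (effRate p h α n * (Real.exp (-(v / effRate p h α n)) - 1)) + τ * v)| := by
            congr 1
            field_simp
            ring
        _ ≤ _ := abs_add_le _ _
        _ ≤ r * α n * oscillation Q x (h n) κ r (α n) + α n / effRate p h α n *
            |τ * (effRate p h α n * (Real.exp (-(v / effRate p h α n)) - 1)) + τ * v| := by
            rw [abs_mul, abs_of_pos (div_pos h1 h2)]
            gcongr
            exact h3 u hu
        _ = _ := by field_simp)
  rw [R.kernel.integral_eq_one] at key
  convert! key using 2
  ring

omit [IsMarkovKernel Q] in
lemma integrable_kernel_sq (R : SmoothingRegime g Q K x h α κ r) :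
    Integrable fun u => K u ^ 2 := by
  obtain ⟨B, hB⟩ := R.kernel.bounded
  have hKint : Integrable K := Integrable.of_integral_ne_zero (by simp [R.kernel.integral_eq_one])
  refine (hKint.const_mul B).mono' (R.kernel.measurable.pow_const 2).aestronglyMeasurable
    (ae_of_all _ fun u => ?_)
  rw [Real.norm_eq_abs, abs_of_nonneg (sq_nonneg _), sq]
  exact mul_le_mul_of_nonneg_right (hB u) (R.kernel.nonneg u)

lemma tendsto_sq_smoothed_moment (R : SmoothingRegime g Q K x h α κ r) {ψ : ℕ → ℝ → ℝ}
    (hψ : ∀ n, Measurable (ψ n)) {B : ℕ → ℝ} (hB : ∀ n y, |ψ n y| ≤ B n)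
    {a δ : ℕ → ℝ} {l : ℝ} (ha : ∀ᶠ n in atTop, 0 < a n) (hδ : Tendsto δ atTop (𝓝 0))
    (hψl : ∀ᶠ n in atTop, ∀ u ∈ Metric.ball x (h n),
      |∫ y, ψ n y ∂(Q u) - a n * l| ≤ a n * δ n) :
    Tendsto (fun n => (∫ e, K ((h n)⁻¹ • (x - e.1)) ^ 2 * ψ n e.2 ∂(pairLaw g Q)) /
      (h n ^ p * a n)) atTop (𝓝 (g x * l * ∫ u, K u ^ 2)) := by
  have := R.isProb
  obtain ⟨L, hL⟩ := R.lipschitz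
  obtain ⟨BK, hBK⟩ := R.kernel.bounded
  exact tendsto_smoothed_moment (H := fun u => K u ^ 2) R.measurable R.nonneg hL
    (R.kernel.measurable.pow_const 2)
    (fun u => pow_le_pow_left₀ (R.kernel.nonneg u) (hBK u) 2) R.integrable_kernel_sq
    (fun u => sq_nonneg _) (fun u hu => R.kernel.support_subset fun h0 => hu (by simp [h0])) x
    R.bandwidth_pos R.bandwidth_lim hψ hB ha hδ hψl

/-- The product moment of two centered exceedances, the second one of the smaller level. -/
lemma tendsto_moment_mul_of_le (R : SmoothingRegime g Q K x h α κ r) {τ₁ τ₂ : ℝ} (h₁ : κ < τ₁)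
    (h₁' : τ₁ < r) (h₂ : κ < τ₂) (h₂' : τ₂ < r) (hle : τ₂ ≤ τ₁) :
    Tendsto (fun n => (∫ e, K ((h n)⁻¹ • (x - e.1)) ^ 2 * (localExcess Q x h α τ₁ 0 n e.2 *
      localExcess Q x h α τ₂ 0 n e.2) ∂(pairLaw g Q)) / (h n ^ p * α n)) atTop
      (𝓝 (g x * τ₂ * ∫ u, K u ^ 2)) := by
  have hκ := R.kappa_pos
  have hr0 : 0 < r := hκ.trans (h₁.trans h₁')
  set Δ : ℕ → ℝ := fun n => oscillation Q x (h n) κ r (α n) with hΔ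
  -- The first term bounds the error in the smaller exceedance probability; the others come from the
  -- centering products, which are of order α².
  have hδ : Tendsto (fun n => r * Δ n + r * (α n * (r + r * Δ n)) + r * (α n * (r + r * Δ n)) +
      r * r * α n) atTop (𝓝 0) := by
    have h1 := R.tendsto_oscillation.const_mul r
    have h2 := (R.level_lim.mul (h1.const_add r)).const_mul r
    have h3 := ((h1.add h2).add h2).add (R.level_lim.const_mul (r * r))
    simpa using h3
  refine R.tendsto_sq_smoothed_moment
    (ψ := fun n y => localExcess Q x h α τ₁ 0 n y * localExcess Q x h α τ₂ 0 n y)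
    (fun n => by fun_prop) (B := fun n => (1 + |τ₁ * α n|) * (1 + |τ₂ * α n|)) (fun n y => ?_)
    R.level_pos hδ ?_
  · rw [abs_mul]
    exact mul_le_mul (abs_localExcess_le _ _ _ _ _ _ _ _) (abs_localExcess_le _ _ _ _ _ _ _ _)
      (abs_nonneg _) (by positivity)
  · have hsmall := (R.level_lim.const_mul τ₁).eventually_lt_const
      (show τ₁ * 0 < 1 by rw [mul_zero]; exact one_pos)
    filter_upwards [R.level_pos, hsmall, R.abs_csf_localQuantile_sub_le h₁ h₁' 0,
      R.abs_csf_localQuantile_sub_le h₂ h₂' 0] with n h0 hs h3 h4 u hu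
    have hτ2 : 0 < τ₂ := hκ.trans h₂
    have hτ1 : 0 < τ₁ := hκ.trans h₁
    have hord : localQuantile Q x h α τ₁ 0 n ≤ localQuantile Q x h α τ₂ 0 n := by
      rw [localQuantile_zero, localQuantile_zero, quantile, quantile]
      rw [R.survival.genInv_le_iff (mul_pos hτ1 h0) hs, R.survival.apply_genInv
        (mul_pos hτ2 h0) ((mul_le_mul_of_nonneg_right hle h0.le).trans_lt hs)]
      exact mul_le_mul_of_nonneg_right hle h0.le
    simp only [localExcess]
    rw [integral_excess_mul_excess u hord]
    have b1 := h3 u hu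
    have b2 := h4 u hu
    simp only [zero_div, neg_zero, Real.exp_zero, mul_one] at b1 b2
    set c₁ := csf Q u (localQuantile Q x h α τ₁ 0 n)
    set c₂ := csf Q u (localQuantile Q x h α τ₂ 0 n)
    have n1 : 0 ≤ c₁ := (csf_mem u _).1
    have n2 : 0 ≤ c₂ := (csf_mem u _).1
    have u1 : c₁ ≤ α n * (r + r * Δ n) := by
      have := (abs_le.1 b1).2
      have := mul_le_mul_of_nonneg_right h₁'.le h0.le
      linarith
    have u2 : c₂ ≤ α n * (r + r * Δ n) := by
      have := (abs_le.1 b2).2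
      have := mul_le_mul_of_nonneg_right h₂'.le h0.le
      linarith
    have e1 : τ₂ * α n * c₁ ≤ α n * (r * (α n * (r + r * Δ n))) := by
      calc τ₂ * α n * c₁ ≤ r * α n * (α n * (r + r * Δ n)) := by gcongr
        _ = _ := by ring
    have e2 : τ₁ * α n * c₂ ≤ α n * (r * (α n * (r + r * Δ n))) := by
      calc τ₁ * α n * c₂ ≤ r * α n * (α n * (r + r * Δ n)) := by gcongr
        _ = _ := by ring
    have e3 : τ₁ * α n * (τ₂ * α n) ≤ α n * (r * r * α n) := by
      calc τ₁ * α n * (τ₂ * α n) ≤ r * α n * (r * α n) := by gcongr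
        _ = _ := by ring
    have p1 : 0 ≤ τ₂ * α n * c₁ := by positivity
    have p2 : 0 ≤ τ₁ * α n * c₂ := by positivity
    have p3 : 0 ≤ τ₁ * α n * (τ₂ * α n) := by positivity
    rw [abs_le] at b2 ⊢
    constructor <;> nlinarith [b2.1, b2.2]

lemma tendsto_moment_mul (R : SmoothingRegime g Q K x h α κ r) {τ₁ τ₂ : ℝ} (h₁ : κ < τ₁)
    (h₁' : τ₁ < r) (h₂ : κ < τ₂) (h₂' : τ₂ < r) :
    Tendsto (fun n => (∫ e, K ((h n)⁻¹ • (x - e.1)) ^ 2 * (localExcess Q x h α τ₁ 0 n e.2 *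
      localExcess Q x h α τ₂ 0 n e.2) ∂(pairLaw g Q)) / (h n ^ p * α n)) atTop
      (𝓝 (g x * min τ₁ τ₂ * ∫ u, K u ^ 2)) := by
  rcases le_total τ₂ τ₁ with hle | hle
  · rw [min_eq_right hle]
    exact R.tendsto_moment_mul_of_le h₁ h₁' h₂ h₂' hle
  · rw [min_eq_left hle]
    refine (R.tendsto_moment_mul_of_le h₂ h₂' h₁ h₁' hle).congr fun n => ?_
    simp_rw [mul_comm (localExcess Q x h α τ₂ 0 n _)]

/-- Exceedances of two local quantiles of the same level differ negligibly. -/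
lemma tendsto_moment_sub_sq (R : SmoothingRegime g Q K x h α κ r) {τ : ℝ} (hκτ : κ < τ)
    (hr : τ < r) (v : ℝ) :
    Tendsto (fun n => (∫ e, K ((h n)⁻¹ • (x - e.1)) ^ 2 * (localExcess Q x h α τ 0 n e.2 -
      localExcess Q x h α τ v n e.2) ^ 2 ∂(pairLaw g Q)) / (h n ^ p * α n)) atTop (𝓝 0) := by
  have hδ : Tendsto (fun n => 2 * r * oscillation Q x (h n) κ r (α n) +
      τ * |1 - Real.exp (-(v / effRate p h α n))|) atTop (𝓝 0) := by
    have h1 := ((R.tendsto_local_factor v).const_sub 1).abs.const_mul τ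
    have h2 := (R.tendsto_oscillation.const_mul (2 * r)).add h1
    simpa using h2
  have hτ : 0 < τ := R.kappa_pos.trans hκτ
  -- The limit is 0 at scale α: between the two local quantiles the conditional mass is o(α),
  -- uniformly on the ball.
  have key := R.tendsto_sq_smoothed_moment (l := 0)
    (ψ := fun n y => (localExcess Q x h α τ 0 n y - localExcess Q x h α τ v n y) ^ 2)
    (fun n => by fun_prop) (B := fun n => (2 * (1 + |τ * α n|)) ^ 2) (fun n y => ?_)
    R.level_pos hδ ?_
  · simpa using key
  · rw [abs_pow]
    refine pow_le_pow_left₀ (abs_nonneg _) ((abs_sub _ _).trans ?_) 2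
    linarith [abs_localExcess_le Q x h α τ 0 n y, abs_localExcess_le Q x h α τ v n y]
  · filter_upwards [R.level_pos, R.abs_csf_localQuantile_sub_le hκτ hr 0,
      R.abs_csf_localQuantile_sub_le hκτ hr v] with n h0 h3 h4 u hu
    have b1 := h3 u hu
    have b2 := h4 u hu
    simp only [zero_div, neg_zero, Real.exp_zero, mul_one] at b1
    have hsq := integral_excess_sub_sq_le (Q := Q) u (localQuantile Q x h α τ 0 n)
      (localQuantile Q x h α τ v n) (τ * α n)
    rw [mul_zero, sub_zero, abs_of_nonneg (integral_nonneg fun y => sq_nonneg _)]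
    refine hsq.trans ?_
    have e : τ * α n - τ * α n * Real.exp (-(v / effRate p h α n)) =
        α n * τ * (1 - Real.exp (-(v / effRate p h α n))) := by ring
    have b3 : |τ * α n - τ * α n * Real.exp (-(v / effRate p h α n))| =
        α n * τ * |1 - Real.exp (-(v / effRate p h α n))| := by
      rw [e, abs_mul, abs_of_pos (mul_pos h0 hτ)]
    calc _ = |(csf Q u (localQuantile Q x h α τ 0 n) - τ * α n) -
          (csf Q u (localQuantile Q x h α τ v n) -
            τ * α n * Real.exp (-(v / effRate p h α n))) +
          (τ * α n - τ * α n * Real.exp (-(v / effRate p h α n)))| := by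
          congr 1; ring
      _ ≤ _ := abs_add_le _ _
      _ ≤ _ := add_le_add_left (abs_sub _ _) _
      _ ≤ r * α n * oscillation Q x (h n) κ r (α n) + r * α n * oscillation Q x (h n) κ r (α n) +
          α n * τ * |1 - Real.exp (-(v / effRate p h α n))| := by
          rw [b3]; gcongr
      _ = _ := by ring

/-- First and second moments of the normalized smoothing weights. -/
lemma tendsto_moment_weights (R : SmoothingRegime g Q K x h α κ r) :
    Tendsto (fun n => (∫ e, K ((h n)⁻¹ • (x - e.1)) ∂(pairLaw g Q)) / h n ^ p) atTop (𝓝 (g x)) ∧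
    Tendsto (fun n => (∫ e, K ((h n)⁻¹ • (x - e.1)) ^ 2 ∂(pairLaw g Q)) / h n ^ p) atTop
      (𝓝 (g x * ∫ u, K u ^ 2)) := by
  have := R.isProb
  obtain ⟨L, hL⟩ := R.lipschitz
  obtain ⟨B, hB⟩ := R.kernel.bounded
  have hKint : Integrable K := Integrable.of_integral_ne_zero (by simp [R.kernel.integral_eq_one])
  constructor
  · have key := tendsto_smoothed_moment (Q := Q) R.measurable R.nonneg hL R.kernel.measurable hB
      hKint R.kernel.nonneg R.kernel.support_subset x R.bandwidth_pos R.bandwidth_lim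
      (ψ := fun _ _ => 1) (fun n => measurable_const) (B := fun _ => 1) (fun n y => by simp)
      (a := fun _ => 1) (l := 1) (δ := fun _ => 0) (by simp) tendsto_const_nhds (by simp)
    simpa [R.kernel.integral_eq_one] using key
  · have key := R.tendsto_sq_smoothed_moment (ψ := fun _ _ => 1) (fun n => measurable_const)
      (B := fun _ => 1) (fun n y => by simp)
      (a := fun _ => 1) (l := 1) (δ := fun _ => 0) (by simp) tendsto_const_nhds (by simp)
    simpa using key

end SmoothingRegime

/-! ### The limit law of the extreme conditional quantile estimators -/

/-- The contribution of one observation to the asymptotically linear part of the estimator. -/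
noncomputable def score {p : ℕ} (Q : Kernel (Cov p) ℝ) (K : Cov p → ℝ) (x : Cov p)
    (h α : ℕ → ℝ) (τ v : ℝ) (n : ℕ) (e : Cov p × ℝ) : ℝ :=
  K ((h n)⁻¹ • (x - e.1)) * localExcess Q x h α τ v n e.2 / effRate p h α n

namespace SmoothingRegime

variable {p : ℕ} {g : Cov p → ℝ} {Q : Kernel (Cov p) ℝ} [IsMarkovKernel Q] {K : Cov p → ℝ}
  {x : Cov p} {h α : ℕ → ℝ} {κ r : ℝ}

omit [IsMarkovKernel Q] in
lemma measurable_score (R : SmoothingRegime g Q K x h α κ r) (τ v : ℝ) (n : ℕ) :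
    Measurable (score Q K x h α τ v n) := by
  have := R.kernel.measurable
  unfold score
  fun_prop

omit [IsMarkovKernel Q] in
-- The centre τα does not depend on `v`, so one bound of order 1/σ serves all shifts.
lemma exists_abs_score_le (R : SmoothingRegime g Q K x h α κ r) (τ : ℝ) :
    ∃ B : ℕ → ℝ, Tendsto B atTop (𝓝 0) ∧ ∀ v n e, |score Q K x h α τ v n e| ≤ B n := by
  obtain ⟨BK, hBK⟩ := R.kernel.bounded
  refine ⟨fun n => BK * (1 + |τ * α n|) / effRate p h α n, ?_, fun v n e => ?_⟩
  · exact ((((R.level_lim.const_mul τ).abs.const_add 1).const_mul BK)).div_atTop R.tendsto_effRate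
  · rw [score, abs_div, abs_of_nonneg (show 0 ≤ effRate p h α n from Real.sqrt_nonneg _), abs_mul,
      abs_of_nonneg (R.kernel.nonneg _)]
    refine div_le_div_of_nonneg_right ?_ (Real.sqrt_nonneg _)
    exact mul_le_mul (hBK _) (abs_localExcess_le _ _ _ _ _ _ _ _) (abs_nonneg _)
      ((R.kernel.nonneg 0).trans (hBK 0))

lemma isProbabilityMeasure_pairLaw (R : SmoothingRegime g Q K x h α κ r) :
    IsProbabilityMeasure (pairLaw g Q) := by
  have := R.isProb
  unfold pairLaw
  infer_instance

/-- As σ² = n h^p α, the factor n/σ equals 1/(h^p α/σ), the normalization of the first moment. -/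
lemma tendsto_integral_score (R : SmoothingRegime g Q K x h α κ r) {τ : ℝ} (hκ : κ < τ)
    (hr : τ < r) (v : ℝ) :
    Tendsto (fun n : ℕ => n * ∫ e, score Q K x h α τ v n e ∂(pairLaw g Q)) atTop
      (𝓝 (-(g x * τ * v))) := by
  refine (R.tendsto_moment_localExcess hκ hr v).congr' ?_
  filter_upwards [R.effRate_sq, R.tendsto_effRate.eventually_gt_atTop 0, R.level_pos]
    with n h1 h2 h3
  have hp := pow_pos (R.bandwidth_pos n) p
  simp only [score]
  rw [integral_div, div_eq_iff (by positivity)]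
  field_simp
  rw [h1]
  ring

lemma tendsto_integral_score_mul (R : SmoothingRegime g Q K x h α κ r) {τ₁ τ₂ : ℝ} (h₁ : κ < τ₁)
    (h₁' : τ₁ < r) (h₂ : κ < τ₂) (h₂' : τ₂ < r) :
    Tendsto (fun n : ℕ => n * ∫ e, score Q K x h α τ₁ 0 n e * score Q K x h α τ₂ 0 n e
      ∂(pairLaw g Q)) atTop (𝓝 (g x * min τ₁ τ₂ * ∫ u, K u ^ 2)) := by
  refine (R.tendsto_moment_mul h₁ h₁' h₂ h₂').congr' ?_
  filter_upwards [R.effRate_sq, R.tendsto_effRate.eventually_gt_atTop 0, R.level_pos]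
    with n h1 h2 h3
  have hp := pow_pos (R.bandwidth_pos n) p
  have : ∀ e, score Q K x h α τ₁ 0 n e * score Q K x h α τ₂ 0 n e =
      (K ((h n)⁻¹ • (x - e.1)) ^ 2 * (localExcess Q x h α τ₁ 0 n e.2 *
        localExcess Q x h α τ₂ 0 n e.2)) / effRate p h α n ^ 2 := fun e => by
    simp only [score]; ring
  simp_rw [this]
  rw [integral_div, div_eq_iff (by positivity)]
  field_simp
  rw [h1]
  ring

lemma tendsto_integral_score_sub_sq (R : SmoothingRegime g Q K x h α κ r) {τ : ℝ} (hκ : κ < τ)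
    (hr : τ < r) (v : ℝ) :
    Tendsto (fun n : ℕ => n * ∫ e, (score Q K x h α τ 0 n e - score Q K x h α τ v n e) ^ 2
      ∂(pairLaw g Q)) atTop (𝓝 0) := by
  refine (R.tendsto_moment_sub_sq hκ hr v).congr' ?_
  filter_upwards [R.effRate_sq, R.tendsto_effRate.eventually_gt_atTop 0, R.level_pos]
    with n h1 h2 h3
  have hp := pow_pos (R.bandwidth_pos n) p
  have : ∀ e, (score Q K x h α τ 0 n e - score Q K x h α τ v n e) ^ 2 =
      (K ((h n)⁻¹ • (x - e.1)) ^ 2 * (localExcess Q x h α τ 0 n e.2 -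
        localExcess Q x h α τ v n e.2) ^ 2) / effRate p h α n ^ 2 := fun e => by
    simp only [score]; ring
  simp_rw [this]
  rw [integral_div, div_eq_iff (by positivity)]
  field_simp
  rw [h1]
  ring

/-- The second moment of a linear combination of scores. -/
lemma tendsto_integral_sum_score_sq (R : SmoothingRegime g Q K x h α κ r) {J : ℕ}
    {τ : Fin J → ℝ} (hκ : ∀ j, κ < τ j) (hr : ∀ j, τ j < r) (θ : Fin J → ℝ) :
    Tendsto (fun n : ℕ => n * ∫ e, (∑ j, θ j * score Q K x h α (τ j) 0 n e) ^ 2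
      ∂(pairLaw g Q)) atTop
      (𝓝 (∑ i, ∑ j, θ i * θ j * (g x * min (τ i) (τ j) * ∫ u, K u ^ 2))) := by
  have := R.isProbabilityMeasure_pairLaw
  have hlim := tendsto_finsetSum Finset.univ fun i (_ : i ∈ Finset.univ) =>
    tendsto_finsetSum Finset.univ fun j (_ : j ∈ Finset.univ) =>
      (R.tendsto_integral_score_mul (hκ i) (hr i) (hκ j) (hr j)).const_mul (θ i * θ j)
  refine hlim.congr fun n => ?_
  have hint : ∀ i j, Integrable (fun e => θ i * θ j *
      (score Q K x h α (τ i) 0 n e * score Q K x h α (τ j) 0 n e)) (pairLaw g Q) := by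
    intro i j
    obtain ⟨B, -, hB⟩ := R.exists_abs_score_le (τ i)
    obtain ⟨B', -, hB'⟩ := R.exists_abs_score_le (τ j)
    refine (integrable_of_abs_le ((R.measurable_score _ _ _).mul (R.measurable_score _ _ _))
      (B := B n * B' n) fun e => ?_).const_mul _
    simp only [Pi.mul_apply]
    rw [abs_mul]
    exact mul_le_mul (hB _ _ _) (hB' _ _ _) (abs_nonneg _) ((abs_nonneg _).trans (hB 0 n e))
  have hexp : ∀ e, (∑ j, θ j * score Q K x h α (τ j) 0 n e) ^ 2 = ∑ i, ∑ j, θ i * θ j *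
      (score Q K x h α (τ i) 0 n e * score Q K x h α (τ j) 0 n e) := fun e => by
    rw [sq, Finset.sum_mul_sum]
    exact Finset.sum_congr rfl fun i _ => Finset.sum_congr rfl fun j _ => by ring
  simp_rw [hexp]
  rw [integral_finsetSum _ fun i _ => integrable_finsetSum _ fun j _ => hint i j, Finset.mul_sum]
  refine Finset.sum_congr rfl fun i _ => ?_
  rw [integral_finsetSum _ fun j _ => hint i j, Finset.mul_sum]
  refine Finset.sum_congr rfl fun j _ => ?_
  rw [integral_const_mul]
  ring

lemma tendsto_integral_sum_score (R : SmoothingRegime g Q K x h α κ r) {J : ℕ}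
    {τ : Fin J → ℝ} (hκ : ∀ j, κ < τ j) (hr : ∀ j, τ j < r) (θ : Fin J → ℝ) :
    Tendsto (fun n : ℕ => n * ∫ e, ∑ j, θ j * score Q K x h α (τ j) 0 n e ∂(pairLaw g Q)) atTop
      (𝓝 0) := by
  have := R.isProbabilityMeasure_pairLaw
  have hlim := tendsto_finsetSum Finset.univ fun j (_ : j ∈ Finset.univ) =>
      (R.tendsto_integral_score (hκ j) (hr j) 0).const_mul (θ j)
  simp only [mul_zero, neg_zero, Finset.sum_const_zero] at hlim
  refine hlim.congr fun n => ?_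
  rw [integral_finsetSum _ fun j _ => ?_, Finset.mul_sum]
  · refine Finset.sum_congr rfl fun j _ => ?_
    rw [integral_const_mul]
    ring
  · obtain ⟨B, -, hB⟩ := R.exists_abs_score_le (τ j)
    exact (integrable_of_abs_le (R.measurable_score _ _ _) (hB 0 n)).const_mul _

omit [IsMarkovKernel Q] in
lemma exists_abs_sum_score_le (R : SmoothingRegime g Q K x h α κ r) {J : ℕ} (τ θ : Fin J → ℝ) :
    ∃ B : ℕ → ℝ, Tendsto B atTop (𝓝 0) ∧
      ∀ n e, |∑ j, θ j * score Q K x h α (τ j) 0 n e| ≤ B n := by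
  choose B hB0 hB using fun j => R.exists_abs_score_le (τ j)
  refine ⟨fun n => ∑ j, |θ j| * B j n, ?_, fun n e => ?_⟩
  · have := tendsto_finsetSum Finset.univ fun j (_ : j ∈ Finset.univ) => (hB0 j).const_mul |θ j|
    simpa using this
  · refine (Finset.abs_sum_le_sum_abs _ _).trans (Finset.sum_le_sum fun j _ => ?_)
    rw [abs_mul]
    exact mul_le_mul_of_nonneg_left (hB j 0 n e) (abs_nonneg _)

variable {Ω : Type*} [MeasurableSpace Ω] {P : Measure Ω} [IsProbabilityMeasure P]
  {X : ℕ → Ω → Cov p} {Y : ℕ → Ω → ℝ}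

/-- The smoothing weights do not vanish simultaneously, with probability tending to one. -/
lemma tendsto_measureReal_sum_weights_nonpos (R : SmoothingRegime g Q K x h α κ r)
    (hS : IsSample P g Q X Y) (hgx : 0 < g x) :
    Tendsto (fun n : ℕ => P.real {ω | ∑ i ∈ Finset.range n, K ((h n)⁻¹ • (x - X i ω)) ≤ 0})
      atTop (𝓝 0) := by
  obtain ⟨BK, hBK⟩ := R.kernel.bounded
  have hKm := R.kernel.measurable
  obtain ⟨hw1, hw2⟩ := R.tendsto_moment_weights
  have hnh : Tendsto (fun n : ℕ => (n : ℝ) * h n ^ p) atTop atTop := by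
    refine tendsto_atTop_mono' _ ?_ R.rate
    filter_upwards [R.level_lim.eventually_lt_const one_pos] with n hn
    exact mul_le_of_le_one_right (mul_nonneg n.cast_nonneg (pow_pos (R.bandwidth_pos n) p).le) hn.le
  have hf : ∀ n : ℕ, Measurable fun e : Cov p × ℝ =>
      K ((h n)⁻¹ • (x - e.1)) / (n * h n ^ p) := fun n => by fun_prop
  have h1 : Tendsto (fun n : ℕ => n * ∫ e, K ((h n)⁻¹ • (x - e.1)) / (n * h n ^ p)
      ∂(pairLaw g Q)) atTop (𝓝 (g x)) := by
    refine hw1.congr' ?_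
    filter_upwards [eventually_gt_atTop 0] with n hn
    have : (0 : ℝ) < n := by exact_mod_cast hn
    have hp := pow_pos (R.bandwidth_pos n) p
    rw [integral_div]
    field_simp
  have h2 : Tendsto (fun n : ℕ => n * ∫ e, (K ((h n)⁻¹ • (x - e.1)) / (n * h n ^ p)) ^ 2
      ∂(pairLaw g Q)) atTop (𝓝 0) := by
    refine (hw2.div_atTop hnh).congr' ?_
    filter_upwards [eventually_gt_atTop 0] with n hn
    have : (0 : ℝ) < n := by exact_mod_cast hn
    have hp := pow_pos (R.bandwidth_pos n) p
    simp_rw [div_pow]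
    rw [integral_div]
    field_simp
  -- The normalized sum of weights tends to g(x) in probability; being nonpositive is a deviation of
  -- at least g(x).
  have key := tendsto_measureReal_sum_sub_ge (P := P) (V := fun i ω => (X i ω, Y i ω))
    (fun i => (hS.measurable_fst i).prodMk (hS.measurable_snd i)) hS.indep hS.law_pair hf
    (B := fun n => BK / (n * h n ^ p)) (fun n e => ?_) h1 h2 hgx
  · refine squeeze_zero' (Eventually.of_forall fun n => measureReal_nonneg) ?_ key
    filter_upwards [eventually_gt_atTop 0] with n hn
    refine measureReal_mono fun ω hω => ?_
    rw [mem_ofPred_eq] at hω ⊢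
    rw [← Finset.sum_div]
    have : (0 : ℝ) < n := by exact_mod_cast hn
    have hp := pow_pos (R.bandwidth_pos n) p
    have hle : (∑ i ∈ Finset.range n, K ((h n)⁻¹ • (x - X i ω))) / (n * h n ^ p) ≤ 0 :=
      div_nonpos_of_nonpos_of_nonneg hω (by positivity)
    exact le_trans (by linarith) (neg_le_abs _)
  · have hp := pow_pos (R.bandwidth_pos n) p
    have hden : (0 : ℝ) ≤ n * h n ^ p := by positivity
    rw [abs_div, abs_of_nonneg (R.kernel.nonneg _), abs_of_nonneg hden]
    exact div_le_div_of_nonneg_right (hBK _) hden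

/-- Asymptotic linearity of the conditional quantile estimator. -/
lemma tendsto_measureReal_quantileEst_sub (R : SmoothingRegime g Q K x h α κ r)
    (hS : IsSample P g Q X Y) (hgx : 0 < g x) {γ : ℝ} {a : ℝ → ℝ}
    (hV : VonMises (csf Q x) γ) (ha : IsAuxiliary (csf Q x) γ a)
    (hend : γ < 0 → endpoint (csf Q x) ≠ 0) {τ : ℝ} (hκ : κ < τ) (hr : τ < r)
    {ε : ℝ} (hε : 0 < ε) :
    Tendsto (fun n : ℕ => P.real {ω | ε ≤ |effRate p h α n *
      (quantile Q x (α n) / a (quantile Q x (α n))) *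
      (quantileEst K (h n) n (fun i => X i ω) (fun i => Y i ω) x (τ * α n) /
        quantile Q x (τ * α n) - 1) -
      ∑ i ∈ Finset.range n, τ ^ (-(min γ 0)) / (τ * g x) *
        score Q K x h α τ 0 n (X i ω, Y i ω)|}) atTop (𝓝 0) := by
  have hτ : 0 < τ := R.kappa_pos.trans hκ
  set C : ℝ := τ ^ (-(min γ 0)) with hC
  have hC0 : 0 < C := Real.rpow_pos_of_pos hτ _
  -- A shift v' moves the mean of the row sum by -g(x) τ v'. With v' = v/C this constant makes D_n
  -- tend to v, and the quantile increment C v' tends to v too.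
  set c : ℝ := C / (τ * g x) with hc
  have hc0 : 0 < c := by positivity
  have hVm : ∀ i, Measurable fun ω => (X i ω, Y i ω) :=
    fun i => (hS.measurable_fst i).prodMk (hS.measurable_snd i)
  have hlaw : ∀ i, P.map (fun ω => (X i ω, Y i ω)) = pairLaw g Q := hS.law_pair
  obtain ⟨B, -, hB⟩ := R.exists_abs_score_le τ
  have := R.isProbabilityMeasure_pairLaw
  refine tendstoInMeasure_sub_of_comparison (P := P) (fun δ hδ => ?_) (fun v => ?_) hε
  · refine exists_measureReal_sum_ge_le (P := P) (V := fun i ω => (X i ω, Y i ω)) hVm hS.indep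
      hlaw (f := fun n e => c * score Q K x h α τ 0 n e)
      (fun n => (R.measurable_score τ 0 n).const_mul c) (B := fun n => c * B n)
      (s := c ^ 2 * (g x * min τ τ * ∫ u, K u ^ 2))
      (fun n e => ?_) ?_ ?_ hδ
    · rw [abs_mul, abs_of_pos hc0]
      exact mul_le_mul_of_nonneg_left (hB 0 n e) hc0.le
    · have := (R.tendsto_integral_score hκ hr 0).const_mul c
      simp only [mul_zero, neg_zero] at this
      refine this.congr fun n => ?_
      rw [integral_const_mul]
      ring
    · refine ((R.tendsto_integral_score_mul hκ hr hκ hr).const_mul (c ^ 2)).congr fun n => ?_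
      simp_rw [mul_pow]
      rw [integral_const_mul]
      simp_rw [sq (score Q K x h α τ 0 n _)]
      ring
  · set v' : ℝ := v / C with hv'
    obtain ⟨hz, hsign⟩ := R.survival.tendsto_quantile_increment hV hend ha R.level_lim R.level_pos
      R.tendsto_effRate hτ v'
    refine ⟨fun n => effRate p h α n * (quantile Q x (α n) / a (quantile Q x (α n))) *
        (localQuantile Q x h α τ v' n / quantile Q x (τ * α n) - 1), fun n ω =>
      ∑ i ∈ Finset.range n, c * (score Q K x h α τ 0 n (X i ω, Y i ω) -
      score Q K x h α τ v' n (X i ω, Y i ω)), ?_, fun η hη => ?_, ?_⟩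
    · convert! hz using 2
      rw [hv', ← hC, div_mul_cancel₀ _ hC0.ne']
    · refine tendsto_measureReal_sum_sub_ge (P := P) (V := fun i ω => (X i ω, Y i ω)) hVm hS.indep
        hlaw (f := fun n e => c * (score Q K x h α τ 0 n e - score Q K x h α τ v' n e))
        (fun n => ((R.measurable_score τ 0 n).sub (R.measurable_score τ v' n)).const_mul c)
        (B := fun n => c * (B n + B n)) (fun n e => ?_) ?_ ?_ hη
      · rw [abs_mul, abs_of_pos hc0]
        exact mul_le_mul_of_nonneg_left ((abs_sub _ _).trans (add_le_add (hB 0 n e) (hB v' n e)))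
          hc0.le
      · have hlim := ((R.tendsto_integral_score hκ hr 0).sub
          (R.tendsto_integral_score hκ hr v')).const_mul c
        have hval : c * (-(g x * τ * 0) - -(g x * τ * v')) = v := by
          rw [hc, hv']; field_simp; ring
        rw [hval] at hlim
        refine hlim.congr fun n => ?_
        rw [integral_const_mul, integral_sub
          (integrable_of_abs_le (R.measurable_score _ _ _) (hB 0 n))
          (integrable_of_abs_le (R.measurable_score _ _ _) (hB v' n))]
        ring
      · have hlim := (R.tendsto_integral_score_sub_sq hκ hr v').const_mul (c ^ 2)
        rw [mul_zero] at hlim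
        refine hlim.congr fun n => ?_
        simp_rw [mul_pow]
        rw [integral_const_mul]
        ring
    -- For large n the two inequalities are equivalent at every outcome where the weights have a
    -- positive sum.
    · refine squeeze_zero' (Eventually.of_forall fun n => measureReal_nonneg) ?_
        (R.tendsto_measureReal_sum_weights_nonpos hS hgx)
      have hsmall := (R.level_lim.const_mul τ).eventually_lt_const
        (show τ * 0 < 1 by rw [mul_zero]; exact one_pos)
      filter_upwards [hsign, hsmall, R.level_pos, R.tendsto_effRate.eventually_gt_atTop 0]
        with n h1 h2 h3 h4
      refine measureReal_mono fun ω hω => ?_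
      rw [mem_ofPred_eq] at hω ⊢
      by_contra! hpos
      refine hω ?_
      have hest := quantileEst_le_iff (n := n) (X := fun i => X i ω) (Y := fun i => Y i ω) (x := x)
        R.kernel.nonneg (R.bandwidth_pos n) hpos (mul_pos hτ h3).le h2
        (t := localQuantile Q x h α τ v' n)
      change 0 < quantile Q x (α n) / a (quantile Q x (α n)) / quantile Q x (τ * α n) at h1
      have hq : quantile Q x (τ * α n) ≠ 0 := by
        intro h0
        rw [h0, div_zero] at h1
        exact lt_irrefl _ h1
      have hL : ∀ y z : ℝ, effRate p h α n * (quantile Q x (α n) / a (quantile Q x (α n))) *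
          (y / quantile Q x (τ * α n) - 1) ≤ effRate p h α n *
          (quantile Q x (α n) / a (quantile Q x (α n))) * (z / quantile Q x (τ * α n) - 1) ↔
          y ≤ z := by
        intro y z
        have hfac : ∀ y, effRate p h α n * (quantile Q x (α n) / a (quantile Q x (α n))) *
          (y / quantile Q x (τ * α n) - 1) = (effRate p h α n * (quantile Q x (α n) /
            a (quantile Q x (α n)) / quantile Q x (τ * α n))) *
            (y - quantile Q x (τ * α n)) := fun y => by
          rw [div_sub_one hq]; ring
        rw [hfac y, hfac z, mul_le_mul_iff_right₀ (mul_pos h4 h1)]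
        exact sub_le_sub_iff_right _
      rw [hL, hest, ← sub_nonpos (b := ∑ i ∈ Finset.range n, c * (_ - _)),
        ← Finset.sum_sub_distrib]
      -- The scores at 0 cancel in W - D, leaving a positive multiple of the row sum that decides
      -- the quantile event.
      have hsum : ∑ i ∈ Finset.range n, (c * score Q K x h α τ 0 n (X i ω, Y i ω) -
          c * (score Q K x h α τ 0 n (X i ω, Y i ω) - score Q K x h α τ v' n (X i ω, Y i ω))) =
          c / effRate p h α n * ∑ i ∈ Finset.range n, K ((h n)⁻¹ • (x - X i ω)) *
            excess (localQuantile Q x h α τ v' n) (τ * α n) (Y i ω) := by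
        rw [Finset.mul_sum]
        refine Finset.sum_congr rfl fun i _ => ?_
        simp only [score, localExcess]
        ring
      rw [hsum]
      have hcpos : 0 < c / effRate p h α n := div_pos hc0 h4
      constructor
      · exact fun hle => mul_nonpos_of_nonneg_of_nonpos hcpos.le hle
      · exact fun hle => nonpos_of_mul_nonpos_right hle hcpos

end SmoothingRegime

/-! ### Covariance form and joint convergence. -/

lemma norm_toLp_le_sum_abs {J : ℕ} (w : EuclideanSpace ℝ (Fin J)) : ‖w‖ ≤ ∑ j, |w j| := by
  rw [EuclideanSpace.norm_eq]
  refine Real.sqrt_le_iff.2 ⟨Finset.sum_nonneg fun j _ => abs_nonneg _, ?_⟩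
  exact Finset.sum_sq_le_sq_sum_of_nonneg fun j _ => abs_nonneg _

/-- Since τ decreases, τ at the smaller index is the larger level, and min(τ_i, τ_j)/(τ_i τ_j) =
1/τ_{i∧j}. -/
lemma dotProduct_limitCov {J : ℕ} {b k γ : ℝ} (hb : b ≠ 0) {τ : Fin J → ℝ} (hτ : StrictAnti τ)
    (hτ0 : ∀ j, 0 < τ j) (t : Fin J → ℝ) :
    t ⬝ᵥ (limitCov (k / b) γ τ).mulVec t = ∑ i, ∑ j, (t i * (τ i ^ (-(min γ 0)) / (τ i * b))) *
      (t j * (τ j ^ (-(min γ 0)) / (τ j * b))) * (b * min (τ i) (τ j) * k) := by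
  simp only [dotProduct, Matrix.mulVec, limitCov, Matrix.of_apply, Finset.mul_sum]
  refine Finset.sum_congr rfl fun i _ => Finset.sum_congr rfl fun j _ => ?_
  have hi := hτ0 i
  have hj := hτ0 j
  rw [Real.mul_rpow hi.le hj.le]
  rcases le_total i j with hij | hij
  · rw [min_eq_left hij, min_eq_right (hτ.antitone hij)]
    field_simp
  · rw [min_eq_right hij, min_eq_left (hτ.antitone hij)]
    field_simp

end ExtremeQuantile

theorem corollary1 {p J : ℕ} (hJ : 0 < J)
    {Ω : Type*} [MeasurableSpace Ω] (P : Measure Ω) [IsProbabilityMeasure P]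
    (g : ExtremeQuantile.Cov p → ℝ)
    (Q : Kernel (ExtremeQuantile.Cov p) ℝ) [IsMarkovKernel Q]
    (X : ℕ → Ω → ExtremeQuantile.Cov p) (Y : ℕ → Ω → ℝ)
    (hsample : ExtremeQuantile.IsSample P g Q X Y)
    (K : ExtremeQuantile.Cov p → ℝ)
    (x : ExtremeQuantile.Cov p) (γ : ℝ) (a : ℝ → ℝ)
    -- von Mises condition at `x`, with an auxiliary function `a(·|x)`
    (hA1 : ExtremeQuantile.VonMises (ExtremeQuantile.csf Q x) γ)
    (ha : ExtremeQuantile.IsAuxiliary (ExtremeQuantile.csf Q x) γ a)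
    (hend : γ < 0 → ExtremeQuantile.endpoint (ExtremeQuantile.csf Q x) ≠ 0)
    -- Lipschitz condition on the density of the covariate
    (hA2 : ∃ c : ℝ, 0 < c ∧ ∀ u v, |g u - g v| ≤ c * dist u v)
    -- condition on the smoothing kernel
    (hA3 : ExtremeQuantile.IsBoundedDensity K)
    (hgx : 0 < g x)
    (τ : Fin J → ℝ) (hτ_anti : StrictAnti τ) (hτ_pos : ∀ j, 0 < τ j) (hτ_le : ∀ j, τ j ≤ 1)
    (h : ℕ → ℝ) (hh_pos : ∀ n, 0 < h n) (hh : Tendsto h atTop (𝓝 0))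
    (α : ℕ → ℝ) (hα : Tendsto α atTop (𝓝 0))
    (hrate : Tendsto (fun n : ℕ => (n : ℝ) * h n ^ p * α n) atTop atTop)
    (hbias : ∃ κ r : ℝ, 0 < κ ∧ (∀ j, κ < τ j) ∧ (∀ j, τ j < r) ∧
      Tendsto (fun n : ℕ => (n : ℝ) * h n ^ p * α n *
        (max (h n) (ExtremeQuantile.oscillation Q x (h n) κ r (α n))) ^ 2) atTop (𝓝 0)) :
    (ExtremeQuantile.limitCov ((∫ u, K u ^ 2) / g x) γ τ).PosSemidef ∧
    TendstoInDistribution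
      (fun (n : ℕ) (ω : Ω) => WithLp.toLp 2 (fun j : Fin J =>
        √((n : ℝ) * h n ^ p * α n) *
          (ExtremeQuantile.quantile Q x (α n) / a (ExtremeQuantile.quantile Q x (α n))) *
          (ExtremeQuantile.quantileEst K (h n) n (fun i => X i ω) (fun i => Y i ω) x
              (τ j * α n) /
            ExtremeQuantile.quantile Q x (τ j * α n) - 1)))
      atTop (id : EuclideanSpace ℝ (Fin J) → EuclideanSpace ℝ (Fin J)) (fun _ => P)
      (multivariateGaussian 0
        (ExtremeQuantile.limitCov ((∫ u, K u ^ 2) / g x) γ τ)) := by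
  obtain ⟨κ, r, hκ0, hκ, hr, hbias⟩ := hbias
  obtain ⟨L, -, hL⟩ := hA2
  have hmarg : IsProbabilityMeasure (volume.withDensity fun u => ENNReal.ofReal (g u)) := by
    rw [← hsample.law_fst 0]
    exact Measure.isProbabilityMeasure_map (hsample.measurable_fst 0).aemeasurable
  have R : ExtremeQuantile.SmoothingRegime g Q K x h α κ r :=
    ⟨hsample.density_measurable, hsample.density_nonneg, hmarg, ⟨L, hL⟩, hA3, hh_pos, hh, hα,
      hrate, hκ0, hbias, ExtremeQuantile.isContSurvival_csf hA1.continuous⟩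
  have hVm : ∀ i, Measurable fun ω => (X i ω, Y i ω) :=
    fun i => (hsample.measurable_fst i).prodMk (hsample.measurable_snd i)
  have hlaw : ∀ i, P.map (fun ω => (X i ω, Y i ω)) = ExtremeQuantile.pairLaw g Q :=
    hsample.law_pair
  set c : Fin J → ℝ := fun j => τ j ^ (-(min γ 0)) / (τ j * g x) with hc
  -- The quadratic form is a limit of nonnegative second moments: this yields positive
  -- semidefiniteness and is also the variance in the central limit theorem.
  have hsecond : ∀ t : Fin J → ℝ, Tendsto (fun n : ℕ => n * ∫ e, (∑ j, t j * c j *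
      ExtremeQuantile.score Q K x h α (τ j) 0 n e) ^ 2 ∂(ExtremeQuantile.pairLaw g Q)) atTop
      (𝓝 (t ⬝ᵥ (ExtremeQuantile.limitCov ((∫ u, K u ^ 2) / g x) γ τ).mulVec t)) := fun t => by
    rw [ExtremeQuantile.dotProduct_limitCov hgx.ne' hτ_anti hτ_pos]
    exact R.tendsto_integral_sum_score_sq hκ hr fun j => t j * c j
  have hpsd : (ExtremeQuantile.limitCov ((∫ u, K u ^ 2) / g x) γ τ).PosSemidef := by
    refine Matrix.PosSemidef.of_dotProduct_mulVec_nonneg (Matrix.IsHermitian.ext fun i j => ?_)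
      fun t => ?_
    · simp [ExtremeQuantile.limitCov, mul_comm (τ i), min_comm i]
    · exact ge_of_tendsto (hsecond t) (Eventually.of_forall fun n =>
        mul_nonneg n.cast_nonneg (integral_nonneg fun e => sq_nonneg _))
  refine ⟨hpsd, ?_⟩
  set W : ℕ → Ω → EuclideanSpace ℝ (Fin J) := fun n ω => WithLp.toLp 2 fun j =>
    ∑ i ∈ Finset.range n, c j * ExtremeQuantile.score Q K x h α (τ j) 0 n (X i ω, Y i ω) with hW
  have hWm : ∀ n, Measurable (W n) := fun n => by
    have : ∀ j i, Measurable fun ω =>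
        c j * ExtremeQuantile.score Q K x h α (τ j) 0 n (X i ω, Y i ω) := fun j i =>
      ((R.measurable_score (τ j) 0 n).comp (hVm i)).const_mul _
    exact (WithLp.measurable_toLp 2 _).comp
      (measurable_pi_lambda _ fun j => Finset.measurable_fun_sum _ fun i _ => this j i)
  have hWlim : TendstoInDistribution W atTop
      (id : EuclideanSpace ℝ (Fin J) → EuclideanSpace ℝ (Fin J)) (fun _ => P)
      (multivariateGaussian 0
        (ExtremeQuantile.limitCov ((∫ u, K u ^ 2) / g x) γ τ)) := by
    refine ⟨fun n => (hWm n).aemeasurable, aemeasurable_id, ?_⟩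
    refine ProbabilityMeasure.tendsto_iff_tendsto_charFun.2 fun t => ?_
    simp only [ProbabilityMeasure.coe_mk, Measure.map_id]
    -- Positive semidefiniteness is what gives the Gaussian law its expected characteristic
    -- function.
    rw [charFun_multivariateGaussian hpsd]
    obtain ⟨B, hB0, hB⟩ := R.exists_abs_sum_score_le τ fun j => t j * c j
    have hclt := ExtremeQuantile.tendsto_integral_exp_sum (P := P)
      (V := fun i ω => (X i ω, Y i ω)) hVm hsample.indep hlaw
      (f := fun n e => ∑ j, t j * c j * ExtremeQuantile.score Q K x h α (τ j) 0 n e)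
      (fun n => Finset.measurable_fun_sum _ fun j _ => (R.measurable_score (τ j) 0 n).const_mul _)
      hB hB0 (R.tendsto_integral_sum_score hκ hr fun j => t j * c j) (hsecond t)
    have hval : Complex.exp ((inner ℝ t 0 : ℝ) * Complex.I -
        ((t.ofLp ⬝ᵥ (ExtremeQuantile.limitCov ((∫ u, K u ^ 2) / g x) γ τ).mulVec t.ofLp : ℝ) : ℂ)
          / 2) =
        Complex.exp (-((t.ofLp ⬝ᵥ
          (ExtremeQuantile.limitCov ((∫ u, K u ^ 2) / g x) γ τ).mulVec t.ofLp : ℝ) : ℂ) / 2) := by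
      simp [neg_div]
    rw [hval]
    refine hclt.congr fun n => ?_
    rw [charFun_apply, integral_map (hWm n).aemeasurable (by fun_prop)]
    refine integral_congr_ae (ae_of_all _ fun ω => ?_)
    -- As in the Cramér–Wold device, each direction `t` gives a scalar row sum of functions of
    -- single observations.
    have hinner : inner ℝ (W n ω) t = ∑ i ∈ Finset.range n, ∑ j, t j * c j *
        ExtremeQuantile.score Q K x h α (τ j) 0 n (X i ω, Y i ω) := by
      rw [Finset.sum_comm, PiLp.inner_apply]
      refine Finset.sum_congr rfl fun j _ => ?_
      simp only [hW, RCLike.inner_apply, conj_trivial, Finset.mul_sum]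
      exact Finset.sum_congr rfl fun i _ => by ring
    simp only [hinner]
  -- Slutsky's lemma; coordinatewise closeness at level ε/J controls the Euclidean norm at level ε.
  refine tendstoInDistribution_of_tendstoInMeasure_sub (X := W) _ id hWlim ?_ fun n => ?_
  · rw [tendstoInMeasure_iff_measureReal_norm]
    intro ε hε
    have hJ' : (0 : ℝ) < J := by exact_mod_cast hJ
    have hlim := tendsto_finsetSum Finset.univ fun j (_ : j ∈ Finset.univ) =>
      R.tendsto_measureReal_quantileEst_sub hsample hgx hA1 ha hend (hκ j) (hr j)
        (div_pos hε hJ')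
    simp only [Finset.sum_const_zero] at hlim
    refine squeeze_zero (fun n => measureReal_nonneg) (fun n => ?_) hlim
    refine (measureReal_mono (fun ω hω => ?_) (measure_ne_top _ _)).trans
      (measureReal_biUnion_finset_le _ _)
    rw [mem_ofPred_eq, Pi.zero_apply, sub_zero] at hω
    by_contra hnot
    simp only [mem_iUnion, mem_ofPred_eq, not_exists, not_le] at hnot
    have hlt := Finset.sum_lt_sum_of_nonempty (s := (Finset.univ : Finset (Fin J)))
      ⟨⟨0, hJ⟩, Finset.mem_univ _⟩ fun j hj => hnot j hj
    rw [Finset.sum_const, Finset.card_univ, Fintype.card_fin, nsmul_eq_mul,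
      mul_div_cancel₀ _ hJ'.ne'] at hlt
    exact absurd (hω.trans (ExtremeQuantile.norm_toLp_le_sum_abs _)) (not_le.2 hlt)
  · refine Measurable.aemeasurable ?_
    refine (WithLp.measurable_toLp 2 _).comp (measurable_pi_lambda _ fun j => ?_)
    exact (((ExtremeQuantile.measurable_quantileEst hA3.measurable hA3.nonneg (hh_pos n)
      hsample.measurable_fst hsample.measurable_snd (τ j * α n)).div_const _).sub_const 1).const_mul
        _
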